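/- **Setting.** Let $0<L\le\infty$ and let $\varphi:(0,L)\to(0,\infty)$ be an Osgood modulus of continuity: $\varphi$ is nondecreasing, $\lim_{r\to0^+}\varphi(r)=0$ and $\int_0^m\frac{dr}{\varphi(r)}=\infty$, where $m\in(0,L]$, $m<\infty$, is a fixed base point. Put $$R(z)=\exp\Big(-\int_z^m\frac{dr}{\varphi(r)}\Big),\quad 0<z<L,\qquad [v]_\varphi=\sup_{0<|x-y|,\ |x-y|<L}\frac{|v(x)-v(y)|}{\varphi(|x-y|)} .$$ Let $u:[0,\infty)\times\mathbb{R}^d\to\mathbb{R}^d$ be a (measurable) vector field that is divergence-free in the sense of distributions at almost every time and has modulus of continuity $\varphi$ in the sense that $\int_0^t[u(s)]_\varphi\,ds<\infty$ for all $t\ge0$. Let $\phi$ be its flow, $\phi(x,t)=x+\int_0^tu(\phi(x,s),s)\,ds$, with back-to-label map $\phi^{-1}(\cdot,t)$, and let $$\mu_{[u]_\varphi,t}(r)=R^{-1}\Big(e^{\int_0^t[u(s)]_\varphi ds}\,R(r)\Big),\qquad r>0 ,$$ with the convention $\mu_{[u]_\varphi,t}(r)=\infty$ if $r\ge L$ or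 if the argument of $R^{-1}$ lies above the range of $R$. A modulus of continuity is a nondecreasing function, positive on $(0,\infty)$, that tends to $0$ at $0^+$. Let $\mu_0:(0,\infty)\to(0,\infty)$ be a modulus of continuity, with $\mu_0(\infty):=\sup\mu_0$. Given $\theta_0:\mathbb{R}^d\to\mathbb{R}$, let $\theta(x,t)=\theta_0(\phi^{-1}(x,t))$ be the solution of the transport equation $\partial_t\theta+u\cdot\nabla\theta=0$, $\theta(\cdot,0)=\theta_0$. **Theorem.** 1. If $|\theta_0(x)-\theta_0(y)|\le K\mu_0(|x-y|)$ for all $x\ne y$, where $K\ge0$, then for every $t\ge0$ the function $\mu_0\circ\mu_{[u]_\varphi,t}$ (possibly with the value $\infty$ away from $0$) is a modulus of continuity and $$|\theta(x,t)-\theta(y,t)|\le K\,\mu_0\circ\mu_{[u]_\varphi,t}(|x-y|)\qquad\text{for all }x\ne y .$$ 2. Let $T>0$ and suppose that $$A(u):=\int_0^1\frac{\mu_0\circ\mu_{[u]_\varphi,T}(r)}{r}\,dr<\infty .$$ Suppose that $\theta_0$ is measurable and that there is $g\in L^2(\mathbb{R}^d)$ with $|\theta_0(x)-\theta_0(y)|\le(g(x)+g(y))\,\mu_0(|x-y|)$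 for almost every pair $(x,y)$. Then for every $t\in[0,T]$ $$\int_{B_1(0)}\int_{\mathbb{R}^d}\frac{|\theta(x,t)-\theta(x+h,t)|^2}{|h|^d}\,\Big(\mu_0\circ\mu_{[u]_\varphi,t}(|h|)\Big)^{-1}dx\,dh\le C\,\|g\|_{L^2(\mathbb{R}^d)}^2\,A(u),$$ where the constant $C$ depends only on the dimension $d$. -/

import Mathlib

open MeasureTheory Set Filter Topology
open scoped ENNReal NNReal

noncomputable section

/-- A modulus of continuity: a nondecreasing function `(0,∞) → (0,∞]` tending to `0` at `0⁺`.
Only its values on `(0,∞)` matter. -/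
structure IsModulus (w : ℝ → ℝ≥0∞) : Prop where
  mono : MonotoneOn w (Ioi 0)
  pos : ∀ r : ℝ, 0 < r → 0 < w r
  tendsto_zero : Tendsto w (𝓝[>] 0) (𝓝 0)

/-- `f` has modulus of continuity `w`, with multiplicative constant `K`. -/
def HasModulus {d : ℕ} (K : ℝ≥0) (w : ℝ → ℝ≥0∞) (f : EuclideanSpace ℝ (Fin d) → ℝ) : Prop :=
  ∀ x y, x ≠ y → ‖f x - f y‖ₑ ≤ K * w (dist x y)

/-- An Osgood modulus of continuity `φ : (0,L) → (0,∞)`, where `0 < L ≤ ∞`. The finite number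
`m ∈ (0,L]` is the base point of the integrals below; `m = L` is allowed when `L` is finite. -/
structure IsOsgood (L : ℝ≥0∞) (m : ℝ) (φ : ℝ → ℝ) : Prop where
  base_pos : 0 < m
  base_le : ENNReal.ofReal m ≤ L
  pos : ∀ r : ℝ, 0 < r → ENNReal.ofReal r < L → 0 < φ r
  mono : MonotoneOn φ {r : ℝ | 0 < r ∧ ENNReal.ofReal r < L}
  tendsto_zero : Tendsto φ (𝓝[>] 0) (𝓝 0)
  osgood : (∫⁻ r in Ioo 0 m, ENNReal.ofReal (1 / φ r)) = ∞

/-- The seminorm `[v]_φ`, the supremum of `|v x - v y| / φ |x - y|` over all pairs `x ≠ y` whose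
distance lies in the domain `(0,L)` of `φ`. -/
def osgoodSeminorm {d : ℕ} (L : ℝ≥0∞) (φ : ℝ → ℝ)
    (v : EuclideanSpace ℝ (Fin d) → EuclideanSpace ℝ (Fin d)) : ℝ≥0∞ :=
  ⨆ (x : EuclideanSpace ℝ (Fin d)) (y : EuclideanSpace ℝ (Fin d))
    (_ : x ≠ y ∧ ENNReal.ofReal (dist x y) < L), ‖v x - v y‖ₑ / ENNReal.ofReal (φ (dist x y))

/-- `R z = exp (- ∫_z^m dr / φ r)` for `z` in `(0,L)`; the integral is oriented if `m < z`. -/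
def osgoodR (m : ℝ) (φ : ℝ → ℝ) (z : ℝ) : ℝ :=
  Real.exp (-∫ r in z..m, 1 / φ r)

/-- The inverse of the increasing function `R` on `(0,L)`,
with value `∞` at the numbers that lie above the range of `R`. -/
def osgoodRInv (L : ℝ≥0∞) (m : ℝ) (φ : ℝ → ℝ) (s : ℝ) : ℝ≥0∞ :=
  ⨅ (z : ℝ) (_ : 0 < z ∧ ENNReal.ofReal z < L ∧ s ≤ osgoodR m φ z), ENNReal.ofReal z

open Classical in
/-- The function `μ_{[u]_φ,t} r = R⁻¹ (exp (∫_0^t [u s]_φ ds) * R r)`,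
with value `∞` for `r ≥ L`, where `R r` is not defined. -/
def lossModulus {d : ℕ} (L : ℝ≥0∞) (m : ℝ) (φ : ℝ → ℝ)
    (u : ℝ → EuclideanSpace ℝ (Fin d) → EuclideanSpace ℝ (Fin d)) (t r : ℝ) : ℝ≥0∞ :=
  if ENNReal.ofReal r < L then
    osgoodRInv L m φ
      (Real.exp (∫⁻ s in Ioo 0 t, osgoodSeminorm L φ (u s)).toReal * osgoodR m φ r)
  else ∞

/-- The value of `μ₀` at an extended number, with `μ₀ ∞ = sup μ₀`. -/
def modulusAt (μ₀ : ℝ → ℝ≥0) (a : ℝ≥0∞) : ℝ≥0∞ :=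
  if a = ∞ then ⨆ (s : ℝ) (_ : 0 < s), (μ₀ s : ℝ≥0∞) else (μ₀ a.toReal : ℝ≥0∞)

/-- The composition `μ₀ ∘ μ_{[u]_φ,t}`. -/
def transportedModulus {d : ℕ} (L : ℝ≥0∞) (m : ℝ) (φ : ℝ → ℝ)
    (u : ℝ → EuclideanSpace ℝ (Fin d) → EuclideanSpace ℝ (Fin d)) (μ₀ : ℝ → ℝ≥0)
    (t r : ℝ) : ℝ≥0∞ :=
  modulusAt μ₀ (lossModulus L m φ u t r)

/-- `div u(t,·) = 0` in the sense of distributions, for almost every `t > 0`. -/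
def IsDivFree {d : ℕ}
    (u : ℝ → EuclideanSpace ℝ (Fin d) → EuclideanSpace ℝ (Fin d)) : Prop :=
  ∀ᵐ t ∂(volume.restrict (Ioi (0 : ℝ))),
    ∀ ψ : EuclideanSpace ℝ (Fin d) → ℝ, ContDiff ℝ ((⊤ : ℕ∞) : WithTop ℕ∞) ψ → HasCompactSupport ψ →
      ∫ x, fderiv ℝ ψ x (u t x) = 0

/-- `Φ t x` is the flow of `u`: each trajectory solves `d/dt Φ t x = u t (Φ t x)`, `Φ 0 x = x`
on `[0,∞)`, in integral form since `u` need not be continuous in time. -/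
def IsFlow {d : ℕ} (u Φ : ℝ → EuclideanSpace ℝ (Fin d) → EuclideanSpace ℝ (Fin d)) : Prop :=
  ∀ x, ∀ t : ℝ, 0 ≤ t →
    IntervalIntegrable (fun s => u s (Φ s x)) volume 0 t ∧
      Φ t x = x + ∫ s in (0 : ℝ)..t, u s (Φ s x)

/-- `θ` is the solution with data `θ₀` of the transport equation of the field with flow `Φ`:
`θ t = θ₀ ∘ (Φ t)⁻¹`, that is, `θ` keeps its initial value along every trajectory. -/
def IsTransported {d : ℕ} (Φ : ℝ → EuclideanSpace ℝ (Fin d) → EuclideanSpace ℝ (Fin d))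
    (θ₀ : EuclideanSpace ℝ (Fin d) → ℝ) (θ : ℝ → EuclideanSpace ℝ (Fin d) → ℝ) : Prop :=
  ∀ t : ℝ, 0 ≤ t → ∀ x, θ t (Φ t x) = θ₀ x

/-- `A = ∫_0^1 μ₀ (μ_{[u]_φ,T} r) / r dr`, a number in `[0,∞]`. -/
def diniIntegral {d : ℕ} (L : ℝ≥0∞) (m : ℝ) (φ : ℝ → ℝ)
    (u : ℝ → EuclideanSpace ℝ (Fin d) → EuclideanSpace ℝ (Fin d)) (μ₀ : ℝ → ℝ≥0)
    (T : ℝ) : ℝ≥0∞ :=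
  ∫⁻ r in Ioo (0 : ℝ) 1, transportedModulus L m φ u μ₀ T r / ENNReal.ofReal r

end

/-! Regularity. Two trajectories at distance `ρ` separate or approach at rate at most `[u]_φ φ(ρ)`.
By Osgood's inequality, moving the distance from `r` up to `z` within time `t`, in either time
direction, requires `∫_r^z 1/φ ≤ ∫_0^t [u]_φ`. Run backward from time `t`, this is exactly the bound
of `|Φ_t⁻¹ x - Φ_t⁻¹ y|` by the loss modulus (`IsFlow.ofReal_dist_le_lossModulus`), and the first
claim follows by composing with `μ₀`.

Energy. The inequality for `θ₀` is pulled back along the inverse flow `Ξ`: the increment of `θ t` is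
at most `(G x + G (x + h)) w(|h|)` with `G = g ∘ Ξ` and `w` the transported modulus. After squaring
and dividing by `w`, one factor `w(|h|)/|h|^d` remains, and polar coordinates turn its integral over
the ball into the Dini integral. What is needed is `‖G‖₂ ≤ ‖g‖₂`, that is, that `Ξ` pushes Lebesgue
measure to something no larger.

Volume. The field need not be differentiable, so no Jacobian of `Φ` is available. Time is cut into
short cells, and `u` integrated over each cell is mollified in space at a fixed scale. The resulting
step `id + w` is onto, as a small Lipschitz perturbation of the identity, and its Jacobian is at
most `exp` of a quadratic quantity because `div w = 0` (`exists_volume_step`). Quadratic errors add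
up to nothing as the cells shrink, while a discrete Osgood argument keeps the composed steps close
to the flow (`TameField.exists_approximation`). Passing to the limit makes `Φ t` onto and gives `vol
(Φ t K) ≤ vol K` for compact `K` (`IsFlow.surjective`, `IsFlow.volume_image_le`).

Measurability. The seminorm is an uncountable supremum; its superlevel sets in time are projections
of Borel sets, hence analytic and Lebesgue measurable. -/

section Analytic

/-! ### Universal measurability of analytic sets. -/

variable {α : Type*} [TopologicalSpace α] [MeasurableSpace α]

theorem isCompact_setOf_forall_le (n : ℕ → ℕ) : IsCompact {x : ℕ → ℕ | ∀ i, x i ≤ n i} := by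
  have : {x : ℕ → ℕ | ∀ i, x i ≤ n i} = Set.pi univ fun i => Iic (n i) := by
    ext x; simp [Pi.le_def]
  rw [this]
  exact isCompact_univ_pi fun i => (Set.finite_Iic (n i)).isCompact

/-- An open neighbourhood of the compact box `∏ [0, n i]` in Baire space contains the set of
sequences bounded by `n` in finitely many coordinates. -/
theorem exists_forall_lt_le_subset_of_isOpen {n : ℕ → ℕ} {V : Set (ℕ → ℕ)} (hV : IsOpen V)
    (h : {x : ℕ → ℕ | ∀ i, x i ≤ n i} ⊆ V) :
    ∃ k, {x : ℕ → ℕ | ∀ i < k, x i ≤ n i} ⊆ V := by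
  have hloc : ∀ x ∈ {x : ℕ → ℕ | ∀ i, x i ≤ n i}, ∃ j, PiNat.cylinder x j ⊆ V := by
    intro x hx
    obtain ⟨s, ⟨y, j, rfl⟩, hxs, hsV⟩ :=
      (PiNat.isTopologicalBasis_cylinders (fun _ : ℕ => ℕ)).isOpen_iff.1 hV x (h hx)
    refine ⟨j, ?_⟩
    rwa [PiNat.mem_cylinder_iff_eq.1 hxs]
  choose! j hj using hloc
  obtain ⟨F, hFC, hF⟩ := (isCompact_setOf_forall_le n).elim_nhds_subcover
    (fun x => PiNat.cylinder x (j x))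
    (fun x _ => (PiNat.isOpen_cylinder _ x (j x)).mem_nhds (PiNat.self_mem_cylinder x _))
  refine ⟨F.sup j, fun y hy => ?_⟩
  have hy' : (fun i => min (y i) (n i)) ∈ {x : ℕ → ℕ | ∀ i, x i ≤ n i} := fun i => min_le_right _ _
  obtain ⟨x, hx⟩ := mem_iUnion.1 (hF hy')
  obtain ⟨hxF, hxc⟩ := mem_iUnion.1 hx
  refine hj x (hFC x hxF) ?_
  rw [PiNat.mem_cylinder_iff] at hxc ⊢
  intro i hi
  rw [← hxc i hi, min_eq_left (hy i (lt_of_lt_of_le hi (Finset.le_sup hxF)))]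

/-- Inner regularity of a finite measure on analytic sets. -/
theorem MeasureTheory.AnalyticSet.exists_isCompact_le (μ : Measure α) [IsFiniteMeasure μ]
    [μ.OuterRegular] {s : Set α} (hs : AnalyticSet s) {r : ℝ≥0∞} (hr : r < μ s) :
    ∃ K ⊆ s, IsCompact K ∧ r ≤ μ K := by
  rw [AnalyticSet] at hs
  obtain rfl | ⟨f, hf, rfl⟩ := hs
  · simp at hr
  have step : ∀ D : Set (ℕ → ℕ), r < μ (f '' D) → ∀ k, ∃ m : ℕ,
      r < μ (f '' (D ∩ {x | x k ≤ m})) := by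
    intro D hD k
    have hU : f '' D = ⋃ m : ℕ, f '' (D ∩ {x | x k ≤ m}) := by
      rw [← image_iUnion, ← inter_iUnion]
      congr 1
      ext x
      simp only [mem_inter_iff, mem_iUnion, mem_ofPred_eq]
      exact ⟨fun h => ⟨h, x k, le_rfl⟩, fun h => h.1⟩
    have hmono : Monotone fun m : ℕ => f '' (D ∩ {x | x k ≤ m}) := by
      intro a b hab
      exact image_mono (inter_subset_inter_right _ fun x hx => le_trans hx hab)
    -- These images need not be measurable, but a measure is continuous from below along every
    -- increasing sequence of sets.
    rw [hU, hmono.measure_iUnion] at hD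
    exact lt_iSup_iff.1 hD
  choose! c hc using step
  let D : ℕ → Set (ℕ → ℕ) := fun k =>
    Nat.rec univ (fun k E => E ∩ {x | x k ≤ c E k}) k
  have hD : ∀ k, r < μ (f '' D k) := by
    intro k
    induction k with
    | zero => simpa [D] using hr
    | succ k ih => exact hc (D k) ih k
  have hDeq : ∀ k, D k = {x | ∀ i < k, x i ≤ c (D i) i} := by
    intro k
    induction k with
    | zero => simp [D]
    | succ k ih =>
      have : D (k + 1) = D k ∩ {x | x k ≤ c (D k) k} := rfl
      rw [this]
      nth_rewrite 1 [ih]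
      ext x
      simp only [mem_inter_iff, mem_ofPred_eq, Nat.lt_succ_iff_lt_or_eq]
      constructor
      · rintro ⟨h1, h2⟩ i (hi | rfl)
        exacts [h1 i hi, h2]
      · exact fun h => ⟨fun i hi => h i (Or.inl hi), h k (Or.inr rfl)⟩
  refine ⟨f '' {x | ∀ i, x i ≤ c (D i) i}, image_subset_range _ _,
    (isCompact_setOf_forall_le _).image hf, ?_⟩
  -- Continuity from above is not available for the images of the `D k`. Outer regularity replaces
  -- it: an open set around the image of the compact box already contains the image of some `D k`.
  rw [Set.measure_eq_iInf_isOpen]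
  refine le_iInf₂ fun U hU => le_iInf fun hUo => ?_
  obtain ⟨k, hk⟩ := exists_forall_lt_le_subset_of_isOpen (hUo.preimage hf) (image_subset_iff.1 hU)
  rw [← hDeq k] at hk
  exact (hD k).le.trans (measure_mono (image_subset_iff.2 hk))

/-- Analytic sets are universally measurable. -/
theorem MeasureTheory.AnalyticSet.nullMeasurableSet [T2Space α] [BorelSpace α] (μ : Measure α) [IsFiniteMeasure μ]
    [μ.OuterRegular] {s : Set α} (hs : AnalyticSet s) : NullMeasurableSet s μ := by
  rcases eq_or_ne (μ s) 0 with h0 | h0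
  · exact NullMeasurableSet.of_null h0
  obtain ⟨r, -, hr, hlim⟩ := exists_seq_strictMono_tendsto' (pos_iff_ne_zero.2 h0)
  choose K hKs hKc hK using fun n => hs.exists_isCompact_le μ (hr n).2
  have hB : MeasurableSet (⋃ n, K n) := MeasurableSet.iUnion fun n => (hKc n).measurableSet
  refine NullMeasurableSet.congr hB.nullMeasurableSet ?_
  refine ae_eq_of_subset_of_measure_ge (iUnion_subset hKs) ?_ hB.nullMeasurableSet
    (measure_ne_top _ _)
  exact le_of_tendsto' hlim fun n => (hK n).trans (measure_mono (subset_iUnion K n))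

end Analytic

theorem aemeasurable_of_nullMeasurableSet_Ioi {α : Type*} [MeasurableSpace α] {μ : Measure α}
    {f : α → ℝ≥0∞} (h : ∀ a, NullMeasurableSet (f ⁻¹' Ioi a) μ) : AEMeasurable f μ := by
  refine NullMeasurable.aemeasurable ?_
  have : @Measurable (NullMeasurableSpace α μ) ℝ≥0∞ _ _ f := measurable_of_Ioi h
  exact fun s hs => this hs

/-! ### Measurability in time of the Osgood seminorm. -/

section Seminorm

variable {d : ℕ} {L : ℝ≥0∞} {m : ℝ} {φ : ℝ → ℝ}

theorem ordConnected_osgoodDomain (L : ℝ≥0∞) :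
    OrdConnected {r : ℝ | 0 < r ∧ ENNReal.ofReal r < L} :=
  ⟨fun _ hx _ hy _ hz => ⟨lt_of_lt_of_le hx.1 hz.1,
    lt_of_le_of_lt (ENNReal.ofReal_le_ofReal hz.2) hy.2⟩⟩

theorem measurableSet_osgoodDomain (L : ℝ≥0∞) :
    MeasurableSet {r : ℝ | 0 < r ∧ ENNReal.ofReal r < L} :=
  (ordConnected_osgoodDomain L).measurableSet

/-- Outside its domain `φ` is arbitrary; cutting it to zero there gives a Borel function that can be
composed with the distance. -/
theorem MonotoneOn.measurable_indicator {β : Type*} [LinearOrder β] [TopologicalSpace β]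
    [OrderTopology β] [SecondCountableTopology β] [MeasurableSpace β] [BorelSpace β] [Zero β]
    {s : Set ℝ} {f : ℝ → β} (hs : OrdConnected s)
    (hf : MonotoneOn f s) : Measurable (s.indicator f) := by
  have hm : MeasurableSet s := hs.measurableSet
  refine measurable_of_restrict_of_restrict_compl hm ?_ ?_
  · have : s.domRestrict (s.indicator f) = s.domRestrict f := by
      ext x; simp
    rw [this]
    exact Monotone.measurable fun x y hxy => hf x.2 y.2 hxy
  · have : sᶜ.domRestrict (s.indicator f) = fun _ => 0 := by
      ext x; simp only [domRestrict_apply]; exact indicator_of_notMem x.2 f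
    rw [this]
    exact measurable_const

/-- The seminorm is a measurable function of time, although it is an uncountable supremum:
its superlevel sets are analytic. -/
theorem IsOsgood.aemeasurable_osgoodSeminorm (hφ : IsOsgood L m φ)
    {u : ℝ → EuclideanSpace ℝ (Fin d) → EuclideanSpace ℝ (Fin d)}
    (hu : Measurable (Function.uncurry u)) (t : ℝ) :
    AEMeasurable (fun s => osgoodSeminorm L φ (u s)) (volume.restrict (Ioo 0 t)) := by
  refine aemeasurable_of_nullMeasurableSet_Ioi fun a => AnalyticSet.nullMeasurableSet _ ?_
  set I := {r : ℝ | 0 < r ∧ ENNReal.ofReal r < L} with hI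
  let E := EuclideanSpace ℝ (Fin d)
  let S : Set (ℝ × E × E) := {p | dist p.2.1 p.2.2 ∈ I ∧
    a < ‖u p.1 p.2.1 - u p.1 p.2.2‖ₑ / ENNReal.ofReal (I.indicator φ (dist p.2.1 p.2.2))}
  have hS : MeasurableSet S := by
    have h1 : Measurable fun p : ℝ × E × E => u p.1 p.2.1 :=
      hu.comp (measurable_fst.prodMk (measurable_fst.comp measurable_snd))
    have h2 : Measurable fun p : ℝ × E × E => u p.1 p.2.2 :=
      hu.comp (measurable_fst.prodMk (measurable_snd.comp measurable_snd))
    have h3 : Measurable fun p : ℝ × E × E => dist p.2.1 p.2.2 := by fun_prop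
    have h4 := (hφ.mono.measurable_indicator (ordConnected_osgoodDomain L)).comp h3
    exact (h3 (measurableSet_osgoodDomain L)).inter
      (measurableSet_lt measurable_const ((h1.sub h2).enorm.div h4.ennreal_ofReal))
  have : (fun s => osgoodSeminorm L φ (u s)) ⁻¹' Ioi a = Prod.fst '' S := by
    ext s
    simp only [mem_preimage, mem_Ioi, osgoodSeminorm, lt_iSup_iff, mem_image, Prod.exists]
    constructor
    · rintro ⟨x, y, ⟨hxy, hd⟩, hlt⟩
      have hmem : dist x y ∈ I := ⟨dist_pos.2 hxy, hd⟩
      refine ⟨s, x, y, ⟨hmem, ?_⟩, rfl⟩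
      simpa [indicator_of_mem hmem] using hlt
    · rintro ⟨s', x, y, ⟨hmem, hlt⟩, rfl⟩
      refine ⟨x, y, ⟨dist_pos.1 hmem.1, hmem.2⟩, ?_⟩
      simpa [indicator_of_mem hmem] using hlt
  rw [this]
  exact (hS.analyticSet).image_of_continuous continuous_fst

end Seminorm

/-! ### Osgood's inequality for a discontinuous modulus. -/

section OsgoodInequality

/-- The `k`-th point of the uniform partition of `[0, t]` into `N` intervals. -/
noncomputable def gridPoint (t : ℝ) (N k : ℕ) : ℝ := t * (k / N)

theorem gridPoint_zero (t : ℝ) (N : ℕ) : gridPoint t N 0 = 0 := by simp [gridPoint]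

theorem gridPoint_self (t : ℝ) {N : ℕ} (hN : 0 < N) : gridPoint t N N = t := by
  have : (N : ℝ) ≠ 0 := by positivity
  simp [gridPoint, this]

theorem gridPoint_mono {t : ℝ} (ht : 0 ≤ t) (N : ℕ) : Monotone (gridPoint t N) := by
  intro a b hab
  unfold gridPoint
  gcongr

theorem gridPoint_mem {t : ℝ} (ht : 0 ≤ t) {N k : ℕ} (hk : k ≤ N) : gridPoint t N k ∈ Icc 0 t := by
  rcases Nat.eq_zero_or_pos N with rfl | hN
  · obtain rfl : k = 0 := by omega
    simp [gridPoint, ht]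
  · constructor
    · simpa [gridPoint_zero] using gridPoint_mono ht N (Nat.zero_le k)
    · simpa [gridPoint_self t hN] using gridPoint_mono ht N hk

/-- Uniform continuity of the primitive of `b`. Such grids serve both Osgood's inequality and the
time stepping that approximates the flow. -/
theorem exists_grid_integral_le {b : ℝ → ℝ} {t : ℝ} (ht : 0 ≤ t)
    (hb : IntervalIntegrable b volume 0 t) {δ : ℝ} (hδ : 0 < δ) :
    ∃ N : ℕ, 0 < N ∧ ∀ k < N, ∫ s in gridPoint t N k..gridPoint t N (k + 1), b s ≤ δ := by
  have hcont : ContinuousOn (fun s => ∫ τ in (0 : ℝ)..s, b τ) (Icc 0 t) := by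
    have := intervalIntegral.continuousOn_primitive_interval
      ((intervalIntegrable_iff_integrableOn_Icc_of_le ht).1 hb |>.mono_set (uIcc_of_le ht).subset)
    rwa [uIcc_of_le ht] at this
  have huc := isCompact_Icc.uniformContinuousOn_of_continuous hcont
  obtain ⟨η, hη, hu⟩ := Metric.uniformContinuousOn_iff_le.1 huc δ hδ
  obtain ⟨N, hN⟩ := exists_nat_gt (t / η)
  have hNpos : 0 < N := by
    have : (0 : ℝ) < N := lt_of_le_of_lt (by positivity) hN
    exact_mod_cast this
  refine ⟨N, hNpos, fun k hk => ?_⟩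
  have hk0 := gridPoint_mem ht hk.le
  have hk1 := gridPoint_mem ht (Nat.succ_le_of_lt hk)
  have hd : dist (gridPoint t N (k + 1)) (gridPoint t N k) ≤ η := by
    have hNr : (0 : ℝ) < N := by exact_mod_cast hNpos
    have : gridPoint t N (k + 1) - gridPoint t N k = t / N := by
      unfold gridPoint; push_cast; field_simp; ring
    rw [Real.dist_eq, this, abs_of_nonneg (by positivity)]
    rw [div_le_iff₀ hNr]
    rw [div_lt_iff₀ hη] at hN
    linarith
  have h := hu _ hk1 _ hk0 hd
  have hI : ∀ s ∈ Icc 0 t, IntervalIntegrable b volume 0 s := fun s hs =>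
    hb.mono_set (by rw [uIcc_of_le hs.1, uIcc_of_le ht]; exact Icc_subset_Icc_right hs.2)
  rw [Real.dist_eq, intervalIntegral.integral_interval_sub_left (hI _ hk1) (hI _ hk0)] at h
  exact (le_abs_self _).trans h

variable {ψ b f : ℝ → ℝ} {t : ℝ}

theorem Monotone.intervalIntegrable_one_div (hψ : Monotone ψ) (hpos : ∀ r, 0 < r → 0 < ψ r)
    {a c : ℝ} (ha : 0 < a) (hc : 0 < c) : IntervalIntegrable (fun r => 1 / ψ r) volume a c := by
  refine AntitoneOn.intervalIntegrable fun x hx y hy hxy => ?_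
  have hx0 : 0 < x := lt_of_lt_of_le (lt_min ha hc) hx.1
  exact one_div_le_one_div_of_le (hpos x hx0) (hψ hxy)

theorem Monotone.integral_one_div_le (hψ : Monotone ψ) (hpos : ∀ r, 0 < r → 0 < ψ r)
    {a c : ℝ} (ha : 0 < a) (hac : a ≤ c) : ∫ r in a..c, 1 / ψ r ≤ (c - a) / ψ a := by
  calc ∫ r in a..c, 1 / ψ r ≤ ∫ r in a..c, 1 / ψ a := by
        refine intervalIntegral.integral_mono_on hac
          (hψ.intervalIntegrable_one_div hpos ha (ha.trans_le hac)) (by simp) fun x hx => ?_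
        exact one_div_le_one_div_of_le (hpos a ha) (hψ hx.1)
    _ = (c - a) / ψ a := by rw [intervalIntegral.integral_const, smul_eq_mul, mul_one_div]

theorem Monotone.intervalIntegrable_mul_comp (hψ : Monotone ψ) (hψ0 : ∀ r, 0 ≤ ψ r) (ht : 0 ≤ t)
    (hb : IntervalIntegrable b volume 0 t) (hf : ContinuousOn f (Icc 0 t)) :
    IntervalIntegrable (fun s => b s * ψ (f s)) volume 0 t := by
  rw [intervalIntegrable_iff_integrableOn_Icc_of_le ht] at hb ⊢
  obtain ⟨M, hM⟩ := (isCompact_Icc.bddAbove_image hf)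
  refine Integrable.mul_bdd (c := ψ M) hb ?_ ?_
  · exact (hψ.measurable.comp_aemeasurable (hf.aemeasurable measurableSet_Icc)).aestronglyMeasurable
  · refine (ae_restrict_iff' measurableSet_Icc).2 (Eventually.of_forall fun s hs => ?_)
    rw [Real.norm_of_nonneg (hψ0 _)]
    exact hψ (hM (mem_image_of_mem f hs))

/-- **Osgood's inequality** in integral form. The modulus `ψ` need not be continuous. -/
theorem osgood_integral_le (hψ : Monotone ψ) (hψ0 : ∀ r, 0 ≤ ψ r) (hpos : ∀ r, 0 < r → 0 < ψ r)
    (ht : 0 ≤ t) (hb : IntervalIntegrable b volume 0 t) (hb0 : ∀ s, 0 ≤ b s)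
    (hf : ContinuousOn f (Icc 0 t)) (hf0 : 0 < f 0)
    (hle : ∀ s ∈ Icc 0 t, f s ≤ f 0 + ∫ τ in (0 : ℝ)..s, b τ * ψ (f τ)) :
    ∫ r in f 0..f t, 1 / ψ r ≤ ∫ s in (0 : ℝ)..t, b s := by
  set a := f 0 with ha
  have hint := hψ.intervalIntegrable_mul_comp hψ0 ht hb hf
  have hsub : ∀ {g : ℝ → ℝ}, IntervalIntegrable g volume 0 t → ∀ s ∈ Icc 0 t, ∀ s' ∈ Icc 0 t,
      IntervalIntegrable g volume s s' := fun hg s hs s' hs' =>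
    hg.mono_set (by rw [uIcc_of_le ht]; exact uIcc_subset_Icc hs hs')
  set F : ℝ → ℝ := fun s => a + ∫ τ in (0 : ℝ)..s, b τ * ψ (f τ) with hF
  have h0mem : (0 : ℝ) ∈ Icc 0 t := ⟨le_rfl, ht⟩
  have htmem : t ∈ Icc 0 t := ⟨ht, le_rfl⟩
  have hFsub : ∀ s ∈ Icc 0 t, ∀ s' ∈ Icc 0 t, F s' - F s = ∫ τ in s..s', b τ * ψ (f τ) := by
    intro s hs s' hs'
    have := intervalIntegral.integral_interval_sub_left
      (hsub hint 0 h0mem s' hs') (hsub hint 0 h0mem s hs)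
    rw [← this]; simp [hF]
  have hFmono : ∀ s ∈ Icc 0 t, ∀ s' ∈ Icc 0 t, s ≤ s' → F s ≤ F s' := by
    intro s hs s' hs' hss
    have : 0 ≤ F s' - F s := by
      rw [hFsub s hs s' hs']
      exact intervalIntegral.integral_nonneg hss fun τ _ => mul_nonneg (hb0 τ) (hψ0 _)
    linarith
  have hFinc : ∀ s ∈ Icc 0 t, ∀ s' ∈ Icc 0 t, s ≤ s' →
      F s' - F s ≤ (∫ τ in s..s', b τ) * ψ (F s') := by
    intro s hs s' hs' hss
    rw [hFsub s hs s' hs', ← intervalIntegral.integral_mul_const]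
    refine intervalIntegral.integral_mono_on hss (hsub hint s hs s' hs')
      ((hsub hb s hs s' hs').mul_const _) fun τ hτ => ?_
    have hτ' : τ ∈ Icc 0 t := ⟨hs.1.trans hτ.1, hτ.2.trans hs'.2⟩
    exact mul_le_mul_of_nonneg_left
      (hψ ((hle τ hτ').trans (hFmono τ hτ' s' hs' hτ.2))) (hb0 τ)
  have hF0 : F 0 = a := by simp [hF]
  have hFpos : ∀ s ∈ Icc 0 t, a ≤ F s := fun s hs => hF0 ▸ hFmono 0 h0mem s hs hs.1
  have hψa : 0 < ψ a := hpos a hf0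
  have hbtot : 0 ≤ ∫ s in (0 : ℝ)..t, b s := intervalIntegral.integral_nonneg ht fun s _ => hb0 s
  -- As `ψ` may jump, the chain rule for `∫ 1/ψ` along the majorant `F` is replaced by a grid with
  -- `∫ b ≤ δ` on each cell. On a cell the left-endpoint bound `ΔF / ψ(F s)` meets `ΔF ≤ (∫ b) ψ(F
  -- s')`; the mismatch costs at most `δ (ψ(F s') - ψ(F s)) / ψ a`, which telescopes. Then `δ → 0`.
  have key : ∀ δ > 0, ∫ r in a..F t, 1 / ψ r ≤
      (∫ s in (0 : ℝ)..t, b s) + δ * ((ψ (F t) - ψ a) / ψ a) := by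
    intro δ hδ
    obtain ⟨N, hN, hNb⟩ := exists_grid_integral_le ht hb hδ
    have hmem : ∀ k ≤ N, gridPoint t N k ∈ Icc 0 t := fun k hk => gridPoint_mem ht hk
    have ind : ∀ k ≤ N, ∫ r in a..F (gridPoint t N k), 1 / ψ r ≤
        (∫ s in (0 : ℝ)..gridPoint t N k, b s) +
          δ * ((ψ (F (gridPoint t N k)) - ψ a) / ψ a) := by
      intro k
      induction k with
      | zero => intro _; simp [gridPoint_zero, hF0]
      | succ k ih =>
        intro hk
        have ih := ih (by omega)
        have hk0 := hmem k (by omega)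
        have hk1 := hmem (k + 1) hk
        have hkk : gridPoint t N k ≤ gridPoint t N (k + 1) := gridPoint_mono ht N (by omega)
        set s := gridPoint t N k
        set s' := gridPoint t N (k + 1)
        have hFs : 0 < F s := hf0.trans_le (hFpos s hk0)
        have hFs' : 0 < F s' := hf0.trans_le (hFpos s' hk1)
        have hβ : ∫ τ in s..s', b τ ≤ δ := hNb k (by omega)
        have hβ0 : 0 ≤ ∫ τ in s..s', b τ := intervalIntegral.integral_nonneg hkk fun s _ => hb0 s
        have e1 := intervalIntegral.integral_add_adjacent_intervals
          (hψ.intervalIntegrable_one_div hpos hf0 hFs)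
          (hψ.intervalIntegrable_one_div hpos hFs hFs')
        have e2 := intervalIntegral.integral_add_adjacent_intervals
          (hsub hb 0 h0mem s hk0) (hsub hb s hk0 s' hk1)
        have e3 := hψ.integral_one_div_le hpos hFs (hFmono s hk0 s' hk1 hkk)
        have hψs : 0 < ψ (F s) := hpos _ hFs
        have hψm : ψ (F s) ≤ ψ (F s') := hψ (hFmono s hk0 s' hk1 hkk)
        have hψas : ψ a ≤ ψ (F s) := hψ (hFpos s hk0)
        have e4 : (F s' - F s) / ψ (F s) ≤
            (∫ τ in s..s', b τ) + δ * ((ψ (F s') - ψ (F s)) / ψ a) := by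
          calc (F s' - F s) / ψ (F s) ≤ ((∫ τ in s..s', b τ) * ψ (F s')) / ψ (F s) := by
                gcongr; exact hFinc s hk0 s' hk1 hkk
            _ = (∫ τ in s..s', b τ) +
                (∫ τ in s..s', b τ) * ((ψ (F s') - ψ (F s)) / ψ (F s)) := by
                field_simp; ring
            _ ≤ _ := by
                have : 0 ≤ ψ (F s') - ψ (F s) := by linarith
                gcongr
        rw [← e1, ← e2]
        have e5 : δ * ((ψ (F s') - ψ a) / ψ a) =
            δ * ((ψ (F s) - ψ a) / ψ a) + δ * ((ψ (F s') - ψ (F s)) / ψ a) := by ring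
        linarith
    simpa [gridPoint_self t hN] using ind N le_rfl
  have hlim : ∫ r in a..F t, 1 / ψ r ≤ ∫ s in (0 : ℝ)..t, b s := by
    have hc : 0 ≤ (ψ (F t) - ψ a) / ψ a :=
      div_nonneg (sub_nonneg.2 (hψ (hFpos t htmem))) hψa.le
    refine le_of_forall_pos_le_add fun ε hε => ?_
    have := key (ε / ((ψ (F t) - ψ a) / ψ a + 1)) (by positivity)
    refine this.trans (by
      gcongr
      rw [div_mul_eq_mul_div, div_le_iff₀ (by positivity)]
      nlinarith)
  rcases le_or_gt a (f t) with hat | hat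
  · refine le_trans ?_ hlim
    have hft : 0 < f t := hf0.trans_le hat
    have hle' : f t ≤ F t := hle t htmem
    have e1 := intervalIntegral.integral_add_adjacent_intervals
      (hψ.intervalIntegrable_one_div hpos hf0 hft)
      (hψ.intervalIntegrable_one_div hpos hft (hft.trans_le hle'))
    have : 0 ≤ ∫ r in f t..F t, 1 / ψ r :=
      intervalIntegral.integral_nonneg hle' fun r _ => one_div_nonneg.2 (hψ0 r)
    linarith
  · rw [intervalIntegral.integral_symm]
    have : 0 ≤ ∫ r in f t..a, 1 / ψ r :=
      intervalIntegral.integral_nonneg hat.le fun r _ => one_div_nonneg.2 (hψ0 r)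
    linarith

/-- A function whose increments are controlled by `b ψ(f)` below the level `z` needs
`∫ b ≥ ∫ 1 / ψ` to climb up to `z`. -/
theorem osgood_level_le (hψ : Monotone ψ) (hψ0 : ∀ r, 0 ≤ ψ r) (hpos : ∀ r, 0 < r → 0 < ψ r)
    (ht : 0 ≤ t) (hb : IntervalIntegrable b volume 0 t) (hb0 : ∀ s, 0 ≤ b s)
    (hf : ContinuousOn f (Icc 0 t)) (hf0 : 0 < f 0) {z : ℝ} (hz0 : f 0 < z) (hzt : z ≤ f t)
    (hle : ∀ s ∈ Icc 0 t, (∀ τ ∈ Icc 0 s, f τ ≤ z) →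
      f s ≤ f 0 + ∫ τ in (0 : ℝ)..s, b τ * ψ (f τ)) :
    ∫ r in f 0..z, 1 / ψ r ≤ ∫ s in (0 : ℝ)..t, b s := by
  -- The first time `s₁` at which `f` reaches `z`: up to it the increment hypothesis applies, and `f
  -- s₁ = z`.
  have hS : IsCompact {s ∈ Icc 0 t | z ≤ f s} := by
    refine (isCompact_Icc.of_isClosed_subset ?_ fun s hs => hs.1)
    exact (hf.preimage_isClosed_of_isClosed isClosed_Icc isClosed_Ici)
  obtain ⟨s₁, ⟨hs₁, hzs₁⟩, hmin⟩ := hS.exists_isLeast ⟨t, ⟨ht, le_rfl⟩, hzt⟩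
  have hlt : ∀ τ ∈ Icc 0 s₁, f τ ≤ z := by
    have hlt' : ∀ τ ∈ Ico 0 s₁, f τ < z := by
      intro τ hτ
      by_contra! hcon
      exact absurd (hmin ⟨⟨hτ.1, hτ.2.le.trans hs₁.2⟩, hcon⟩) (not_le.2 hτ.2)
    intro τ hτ
    rcases hτ.2.lt_or_eq with h | rfl
    · exact (hlt' τ ⟨hτ.1, h⟩).le
    by_contra! hcon
    obtain ⟨c, hc, hfc⟩ := intermediate_value_Icc hτ.1
      (hf.mono (Icc_subset_Icc_right hs₁.2)) ⟨hz0.le, hcon.le⟩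
    rcases hc.2.lt_or_eq with h | rfl
    · exact absurd hfc (hlt' c ⟨hc.1, h⟩).ne
    · linarith
  have hsub : Icc 0 s₁ ⊆ Icc 0 t := Icc_subset_Icc_right hs₁.2
  have hfs : f s₁ = z := le_antisymm (hlt s₁ ⟨hs₁.1, le_rfl⟩) hzs₁
  have hbs : IntervalIntegrable b volume 0 s₁ :=
    hb.mono_set (by rw [uIcc_of_le hs₁.1, uIcc_of_le ht]; exact hsub)
  have := osgood_integral_le hψ hψ0 hpos hs₁.1 hbs hb0 (hf.mono hsub) hf0 fun s hs =>
    hle s (hsub hs) fun τ hτ => hlt τ ⟨hτ.1, hτ.2.trans hs.2⟩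
  rw [hfs] at this
  refine this.trans ?_
  exact intervalIntegral.integral_mono_interval le_rfl hs₁.1 hs₁.2
    (Eventually.of_forall hb0) hb

/-- The version of `osgood_level_le` that runs backward in time. -/
theorem osgood_level_le_backward (hψ : Monotone ψ) (hψ0 : ∀ r, 0 ≤ ψ r)
    (hpos : ∀ r, 0 < r → 0 < ψ r)
    (ht : 0 ≤ t) (hb : IntervalIntegrable b volume 0 t) (hb0 : ∀ s, 0 ≤ b s)
    (hf : ContinuousOn f (Icc 0 t)) (hft : 0 < f t) {z : ℝ} (hzt : f t < z) (hz0 : z ≤ f 0)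
    (hle : ∀ s ∈ Icc 0 t, (∀ τ ∈ Icc s t, f τ ≤ z) →
      f s ≤ f t + ∫ τ in s..t, b τ * ψ (f τ)) :
    ∫ r in f t..z, 1 / ψ r ≤ ∫ s in (0 : ℝ)..t, b s := by
  have hmaps : MapsTo (fun s => t - s) (Icc 0 t) (Icc 0 t) := fun s hs =>
    ⟨by linarith [hs.2], by linarith [hs.1]⟩
  have hb' : IntervalIntegrable (fun s => b (t - s)) volume 0 t := by
    simpa using (hb.comp_sub_left t).symm
  have := osgood_level_le (f := fun s => f (t - s)) (b := fun s => b (t - s)) (z := z)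
    hψ hψ0 hpos ht hb' (fun s => hb0 _) (hf.comp (by fun_prop) hmaps) (by simpa using hft)
    (by simpa using hzt) (by simpa using hz0) ?_
  · simpa [intervalIntegral.integral_comp_sub_left (fun s => b s) t] using this
  · intro s hs hs'
    have h1 := hle (t - s) (hmaps hs) fun τ hτ => by
      have := hs' (t - τ) ⟨by linarith [hτ.2], by linarith [hτ.1]⟩
      simpa using this
    rw [intervalIntegral.integral_comp_sub_left (fun s => b s * ψ (f s)) t]
    simpa using h1

end OsgoodInequality

/-! ### The function `R`, its inverse, and the loss modulus. -/

section Modulus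

variable {d : ℕ} {L : ℝ≥0∞} {m : ℝ} {φ : ℝ → ℝ}

namespace IsOsgood

theorem intervalIntegrable_one_div (hφ : IsOsgood L m φ) {a c : ℝ} (ha : 0 < a) (hc : 0 < c)
    (haL : ENNReal.ofReal a ≤ L) (hcL : ENNReal.ofReal c ≤ L) :
    IntervalIntegrable (fun r => 1 / φ r) volume a c := by
  wlog hac : a ≤ c generalizing a c
  · exact (this hc ha hcL haL (le_of_not_ge hac)).symm
  rcases hac.eq_or_lt with rfl | hac
  · exact IntervalIntegrable.refl
  rw [intervalIntegrable_iff_integrableOn_Ioo_of_le hac.le]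
  have hdom : ∀ x ∈ Ioo a c, 0 < x ∧ ENNReal.ofReal x < L := fun x hx =>
    ⟨ha.trans hx.1, ((ENNReal.ofReal_lt_ofReal_iff hc).2 hx.2).trans_le hcL⟩
  have haL' : ENNReal.ofReal a < L := ((ENNReal.ofReal_lt_ofReal_iff hc).2 hac).trans_le hcL
  have hanti : AntitoneOn (fun r => 1 / φ r) (Ioo a c) := fun x hx y hy hxy =>
    one_div_le_one_div_of_le (hφ.pos x (hdom x hx).1 (hdom x hx).2)
      (hφ.mono (hdom x hx) (hdom y hy) hxy)
  refine Integrable.of_bound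
    (aemeasurable_restrict_of_antitoneOn measurableSet_Ioo hanti).aestronglyMeasurable (1 / φ a) ?_
  refine (ae_restrict_iff' measurableSet_Ioo).2 (Eventually.of_forall fun x hx => ?_)
  have h1 := hφ.pos a ha haL'
  have h2 := hφ.pos x (hdom x hx).1 (hdom x hx).2
  rw [Real.norm_of_nonneg (by positivity)]
  exact one_div_le_one_div_of_le h1 (hφ.mono ⟨ha, haL'⟩ (hdom x hx) hx.1.le)

theorem integral_one_div_pos (hφ : IsOsgood L m φ) {a c : ℝ} (ha : 0 < a) (hac : a < c)
    (hcL : ENNReal.ofReal c ≤ L) : 0 < ∫ r in a..c, 1 / φ r := by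
  have hc := ha.trans hac
  refine intervalIntegral.intervalIntegral_pos_of_pos_on (hφ.intervalIntegrable_one_div ha hc
    ((ENNReal.ofReal_le_ofReal hac.le).trans hcL) hcL) (fun x hx => ?_) hac
  exact one_div_pos.2 (hφ.pos x (ha.trans hx.1)
    (((ENNReal.ofReal_lt_ofReal_iff hc).2 hx.2).trans_le hcL))

/-- The base point drops out of ratios: `exp G * R a ≤ R c` says that `∫_a^c 1/φ ≥ G`, which is how
the loss modulus meets Osgood's inequality. -/
theorem osgoodR_eq_mul (hφ : IsOsgood L m φ) {a c : ℝ} (ha : 0 < a) (hc : 0 < c)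
    (haL : ENNReal.ofReal a < L) (hcL : ENNReal.ofReal c < L) :
    osgoodR m φ c = Real.exp (∫ r in a..c, 1 / φ r) * osgoodR m φ a := by
  have h := intervalIntegral.integral_add_adjacent_intervals
    (hφ.intervalIntegrable_one_div ha hc haL.le hcL.le)
    (hφ.intervalIntegrable_one_div hc hφ.base_pos hcL.le hφ.base_le)
  unfold osgoodR
  rw [← Real.exp_add, ← h]
  congr 1; ring

theorem osgoodR_pos (m : ℝ) (φ : ℝ → ℝ) (z : ℝ) : 0 < osgoodR m φ z := Real.exp_pos _

theorem osgoodR_strictMonoOn (hφ : IsOsgood L m φ) :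
    StrictMonoOn (osgoodR m φ) {r : ℝ | 0 < r ∧ ENNReal.ofReal r < L} := by
  intro a ha c hc hac
  rw [hφ.osgoodR_eq_mul ha.1 hc.1 ha.2 hc.2]
  have := hφ.integral_one_div_pos ha.1 hac hc.2.le
  have h1 := Real.one_lt_exp_iff.2 this
  nlinarith [osgoodR_pos m φ a]

/-- Osgood's condition: the integral of `1 / φ` diverges at `0`. -/
theorem exists_lt_integral (hφ : IsOsgood L m φ) (B : ℝ) {c : ℝ} (hc : 0 < c)
    (hcL : ENNReal.ofReal c ≤ L) :
    ∃ a, 0 < a ∧ a < c ∧ ∀ a', 0 < a' → a' ≤ a → B < ∫ r in a'..c, 1 / φ r := by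
  by_contra! hcon
  have hm := hφ.base_pos
  set D := ∫ r in c..m, 1 / φ r with hD
  -- If the claim failed, all the integrals from `a` to `m` would share one bound, and exhausting
  -- `(0, m)` from inside would make the Osgood integral finite.
  have hbound : ∀ a, 0 < a → a ≤ m → ∫ r in a..m, 1 / φ r ≤ B + D := by
    intro a ha ham
    obtain ⟨a', ha'0, ha'a, ha'B⟩ := hcon (min a (c / 2)) (by positivity)
      ((min_le_right _ _).trans_lt (by linarith))
    have ha'L : ENNReal.ofReal a' ≤ L :=
      (ENNReal.ofReal_le_ofReal (ha'a.trans ((min_le_right _ _).trans (by linarith)))).trans hcL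
    have haL : ENNReal.ofReal a ≤ L := (ENNReal.ofReal_le_ofReal ham).trans hφ.base_le
    have e1 := intervalIntegral.integral_add_adjacent_intervals
      (hφ.intervalIntegrable_one_div ha'0 hc ha'L hcL)
      (hφ.intervalIntegrable_one_div hc hm hcL hφ.base_le)
    have e2 := intervalIntegral.integral_add_adjacent_intervals
      (hφ.intervalIntegrable_one_div ha'0 ha ha'L haL)
      (hφ.intervalIntegrable_one_div ha hm haL hφ.base_le)
    have : 0 ≤ ∫ r in a'..a, 1 / φ r := by
      rcases (ha'a.trans (min_le_left _ _)).eq_or_lt with h | h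
      · rw [h]; simp
      · exact (hφ.integral_one_div_pos ha'0 h haL).le
    linarith
  have hU : Ioo 0 m = ⋃ n : ℕ, Ioo (m / (n + 1)) m := by
    ext x
    simp only [mem_Ioo, mem_iUnion]
    constructor
    · rintro ⟨h0, h1⟩
      obtain ⟨n, hn⟩ := exists_nat_gt (m / x)
      refine ⟨n, ?_, h1⟩
      rw [div_lt_iff₀ h0] at hn
      rw [div_lt_iff₀ (by positivity)]
      nlinarith
    · rintro ⟨n, h0, h1⟩
      exact ⟨lt_trans (by positivity) h0, h1⟩
  have hdir : Directed (· ⊆ ·) fun n : ℕ => Ioo (m / ((n : ℝ) + 1)) m := by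
    refine Monotone.directed_le fun i j hij => Ioo_subset_Ioo_left ?_
    have : (i : ℝ) ≤ j := by exact_mod_cast hij
    gcongr
  have hle : (∫⁻ r in Ioo 0 m, ENNReal.ofReal (1 / φ r)) ≤ ENNReal.ofReal (B + D) := by
    rw [hU, setLIntegral_iUnion_of_directed _ hdir]
    refine iSup_le fun n => ?_
    have ha : 0 < m / ((n : ℝ) + 1) := by positivity
    have ham : m / ((n : ℝ) + 1) ≤ m := div_le_self hm.le (by linarith [n.cast_nonneg (α := ℝ)])
    have haL : ENNReal.ofReal (m / ((n : ℝ) + 1)) ≤ L :=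
      (ENNReal.ofReal_le_ofReal ham).trans hφ.base_le
    have hint := hφ.intervalIntegrable_one_div ha hm haL hφ.base_le
    rw [← ofReal_integral_eq_lintegral_ofReal
      ((intervalIntegrable_iff_integrableOn_Ioo_of_le ham).1 hint)]
    · refine ENNReal.ofReal_le_ofReal ?_
      rw [← integral_Ioc_eq_integral_Ioo, ← intervalIntegral.integral_of_le ham]
      exact hbound _ ha ham
    · refine (ae_restrict_iff' measurableSet_Ioo).2 (Eventually.of_forall fun x hx => ?_)
      exact (one_div_pos.2 (hφ.pos x (ha.trans hx.1)
        (((ENNReal.ofReal_lt_ofReal_iff hm).2 hx.2).trans_le hφ.base_le))).le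
  rw [hφ.osgood] at hle
  exact ENNReal.ofReal_ne_top (top_le_iff.1 hle)

/-- A radius inside the domain of `φ`. -/
theorem exists_radius (hφ : IsOsgood L m φ) :
    ∃ ρ, 0 < ρ ∧ ENNReal.ofReal ρ < L :=
  ⟨m / 2, half_pos hφ.base_pos, lt_of_lt_of_le
    ((ENNReal.ofReal_lt_ofReal_iff hφ.base_pos).2 (half_lt_self hφ.base_pos)) hφ.base_le⟩

end IsOsgood

/-- The modulus `φ` frozen beyond the radius `ρ`, and extended by zero. -/
noncomputable def cutModulus (φ : ℝ → ℝ) (ρ r : ℝ) : ℝ := if r ≤ 0 then 0 else φ (min r ρ)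

namespace IsOsgood

variable {ρ : ℝ}

theorem ofReal_min_lt (hρL : ENNReal.ofReal ρ < L) (r : ℝ) : ENNReal.ofReal (min r ρ) < L :=
  (ENNReal.ofReal_le_ofReal (min_le_right _ _)).trans_lt hρL

theorem cutModulus_pos (hφ : IsOsgood L m φ) (hρ : 0 < ρ) (hρL : ENNReal.ofReal ρ < L) :
    ∀ r, 0 < r → 0 < cutModulus φ ρ r := by
  intro r hr
  rw [cutModulus, if_neg hr.not_ge]
  exact hφ.pos _ (lt_min hr hρ) (ofReal_min_lt hρL r)

theorem cutModulus_nonneg (hφ : IsOsgood L m φ) (hρ : 0 < ρ) (hρL : ENNReal.ofReal ρ < L) :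
    ∀ r, 0 ≤ cutModulus φ ρ r := by
  intro r
  rcases le_or_gt r 0 with h | h
  · rw [cutModulus, if_pos h]
  · exact (hφ.cutModulus_pos hρ hρL r h).le

theorem cutModulus_mono (hφ : IsOsgood L m φ) (hρ : 0 < ρ) (hρL : ENNReal.ofReal ρ < L) :
    Monotone (cutModulus φ ρ) := by
  intro r s hrs
  rcases le_or_gt r 0 with h | h
  · rw [cutModulus, if_pos h]
    exact hφ.cutModulus_nonneg hρ hρL s
  · rw [cutModulus, cutModulus, if_neg h.not_ge, if_neg (h.trans_le hrs).not_ge]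
    exact hφ.mono ⟨lt_min h hρ, ofReal_min_lt hρL r⟩
      ⟨lt_min (h.trans_le hrs) hρ, ofReal_min_lt hρL s⟩ (min_le_min_right _ hrs)

theorem _root_.cutModulus_of_mem {r : ℝ} (hr : 0 < r) (hrρ : r ≤ ρ) :
    cutModulus φ ρ r = φ r := by
  rw [cutModulus, if_neg hr.not_ge, min_eq_left hrρ]

theorem _root_.integral_one_div_cutModulus {a c : ℝ} (ha : 0 < a) (hac : a ≤ c) (hcρ : c ≤ ρ) :
    ∫ r in a..c, 1 / cutModulus φ ρ r = ∫ r in a..c, 1 / φ r := by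
  refine intervalIntegral.integral_congr fun r hr => ?_
  rw [uIcc_of_le hac] at hr
  rw [cutModulus_of_mem (ha.trans_le hr.1) (hr.2.trans hcρ)]

end IsOsgood

/-- The total growth exponent `∫_0^t [u(s)]_φ ds`. -/
noncomputable def growth (L : ℝ≥0∞) (φ : ℝ → ℝ)
    (u : ℝ → EuclideanSpace ℝ (Fin d) → EuclideanSpace ℝ (Fin d)) (t : ℝ) : ℝ :=
  (∫⁻ s in Ioo 0 t, osgoodSeminorm L φ (u s)).toReal

variable {u : ℝ → EuclideanSpace ℝ (Fin d) → EuclideanSpace ℝ (Fin d)} {t : ℝ}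

theorem growth_nonneg : 0 ≤ growth L φ u t := ENNReal.toReal_nonneg

theorem growth_mono (hu : ∀ t : ℝ, (∫⁻ s in Ioo 0 t, osgoodSeminorm L φ (u s)) ≠ ∞)
    {s t : ℝ} (hst : s ≤ t) : growth L φ u s ≤ growth L φ u t :=
  ENNReal.toReal_mono (hu t) (lintegral_mono_set (Ioo_subset_Ioo_right hst))

theorem lossModulus_of_lt {r : ℝ} (hr : ENNReal.ofReal r < L) :
    lossModulus L m φ u t r =
      osgoodRInv L m φ (Real.exp (growth L φ u t) * osgoodR m φ r) := if_pos hr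

theorem lossModulus_of_le {r : ℝ} (hr : L ≤ ENNReal.ofReal r) :
    lossModulus L m φ u t r = ∞ := if_neg hr.not_gt

theorem osgoodRInv_mono : Monotone (osgoodRInv L m φ) := by
  intro s s' hs
  refine le_iInf₂ fun z hz => ?_
  exact iInf₂_le z ⟨hz.1, hz.2.1, hs.trans hz.2.2⟩

/-- The exponential factor is at least `1` and `R` increases. The resulting positivity of the loss
modulus matters too: `μ₀` is only controlled on `(0,∞)`, so `modulusAt_mono` cannot start from `0`.
-/
theorem le_lossModulus (hφ : IsOsgood L m φ) {r : ℝ} (hr : 0 < r) :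
    ENNReal.ofReal r ≤ lossModulus L m φ u t r := by
  rcases lt_or_ge (ENNReal.ofReal r) L with h | h
  · rw [lossModulus_of_lt h]
    refine le_iInf₂ fun z hz => ENNReal.ofReal_le_ofReal ?_
    by_contra! hzr
    have h1 := hφ.osgoodR_strictMonoOn ⟨hz.1, hz.2.1⟩ ⟨hr, h⟩ hzr
    have h2 : 1 ≤ Real.exp (growth L φ u t) := Real.one_le_exp growth_nonneg
    nlinarith [hz.2.2, IsOsgood.osgoodR_pos m φ r]
  · rw [lossModulus_of_le h]; exact le_top

theorem lossModulus_monotoneOn (hφ : IsOsgood L m φ) :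
    MonotoneOn (lossModulus L m φ u t) (Ioi 0) := by
  intro r hr s hs hrs
  rcases lt_or_ge (ENNReal.ofReal s) L with h | h
  · have h' := (ENNReal.ofReal_le_ofReal hrs).trans_lt h
    rw [lossModulus_of_lt h, lossModulus_of_lt h']
    refine osgoodRInv_mono (mul_le_mul_of_nonneg_left ?_ (Real.exp_pos _).le)
    exact hφ.osgoodR_strictMonoOn.monotoneOn ⟨hr, h'⟩ ⟨hs, h⟩ hrs
  · rw [lossModulus_of_le h]; exact le_top

theorem lossModulus_mono_time
    (hu : ∀ t : ℝ, (∫⁻ s in Ioo 0 t, osgoodSeminorm L φ (u s)) ≠ ∞) {T : ℝ} (htT : t ≤ T) (r : ℝ) :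
    lossModulus L m φ u t r ≤ lossModulus L m φ u T r := by
  rcases lt_or_ge (ENNReal.ofReal r) L with h | h
  · rw [lossModulus_of_lt h, lossModulus_of_lt h]
    refine osgoodRInv_mono (mul_le_mul_of_nonneg_right ?_ (IsOsgood.osgoodR_pos m φ r).le)
    exact Real.exp_le_exp.2 (growth_mono hu htT)
  · rw [lossModulus_of_le h, lossModulus_of_le h]

/-- The loss modulus is finite, and small, at small distances. -/
theorem exists_lossModulus_le (hφ : IsOsgood L m φ) {z : ℝ} (hz : 0 < z)
    (hzL : ENNReal.ofReal z < L) :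
    ∃ r₀, 0 < r₀ ∧ ∀ r, 0 < r → r ≤ r₀ → lossModulus L m φ u t r ≤ ENNReal.ofReal z := by
  obtain ⟨a, ha, haz, hB⟩ := hφ.exists_lt_integral (growth L φ u t) hz hzL.le
  refine ⟨a, ha, fun r hr hra => ?_⟩
  have hrL : ENNReal.ofReal r < L :=
    (ENNReal.ofReal_le_ofReal (hra.trans haz.le)).trans_lt hzL
  rw [lossModulus_of_lt hrL]
  refine iInf₂_le z ⟨hz, hzL, ?_⟩
  rw [hφ.osgoodR_eq_mul hr hz hrL hzL]
  exact mul_le_mul_of_nonneg_right (Real.exp_le_exp.2 (hB r hr hra).le)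
    (IsOsgood.osgoodR_pos m φ r).le

variable {μ₀ : ℝ → ℝ≥0}

theorem modulusAt_mono (hμ : IsModulus fun r => (μ₀ r : ℝ≥0∞)) {a c : ℝ≥0∞} (ha : 0 < a)
    (hac : a ≤ c) : modulusAt μ₀ a ≤ modulusAt μ₀ c := by
  unfold modulusAt
  rcases eq_or_ne c ∞ with rfl | hc
  · rw [if_pos rfl]
    split_ifs with h
    · exact le_rfl
    · exact le_iSup₂_of_le a.toReal (ENNReal.toReal_pos ha.ne' h) le_rfl
  · have ha' : a ≠ ∞ := ne_top_of_le_ne_top hc hac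
    rw [if_neg hc, if_neg ha']
    exact hμ.mono (ENNReal.toReal_pos ha.ne' ha') (ENNReal.toReal_pos (ha.trans_le hac).ne' hc)
      (ENNReal.toReal_mono hc hac)

theorem modulusAt_ofReal {r : ℝ} (hr : 0 ≤ r) : modulusAt μ₀ (ENNReal.ofReal r) = μ₀ r := by
  rw [modulusAt, if_neg ENNReal.ofReal_ne_top, ENNReal.toReal_ofReal hr]

theorem le_transportedModulus (hφ : IsOsgood L m φ) (hμ : IsModulus fun r => (μ₀ r : ℝ≥0∞))
    {r : ℝ} (hr : 0 < r) : (μ₀ r : ℝ≥0∞) ≤ transportedModulus L m φ u μ₀ t r := by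
  rw [← modulusAt_ofReal hr.le]
  exact modulusAt_mono hμ (ENNReal.ofReal_pos.2 hr) (le_lossModulus hφ hr)

theorem transportedModulus_mono_time (hφ : IsOsgood L m φ)
    (hμ : IsModulus fun r => (μ₀ r : ℝ≥0∞))
    (hu : ∀ t : ℝ, (∫⁻ s in Ioo 0 t, osgoodSeminorm L φ (u s)) ≠ ∞) {T : ℝ} (htT : t ≤ T)
    {r : ℝ} (hr : 0 < r) :
    transportedModulus L m φ u μ₀ t r ≤ transportedModulus L m φ u μ₀ T r :=
  modulusAt_mono hμ ((ENNReal.ofReal_pos.2 hr).trans_le (le_lossModulus hφ hr))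
    (lossModulus_mono_time hu htT r)

theorem isModulus_transportedModulus (hφ : IsOsgood L m φ)
    (hμ : IsModulus fun r => (μ₀ r : ℝ≥0∞)) :
    IsModulus (transportedModulus L m φ u μ₀ t) where
  mono := by
    intro r hr s hs hrs
    exact modulusAt_mono hμ ((ENNReal.ofReal_pos.2 hr).trans_le (le_lossModulus hφ hr))
      (lossModulus_monotoneOn hφ hr hs hrs)
  pos := fun r hr => (hμ.pos r hr).trans_le (le_transportedModulus hφ hμ hr)
  tendsto_zero := by
    rw [ENNReal.tendsto_nhds_zero]
    intro ε hε
    obtain ⟨ρ, hρ, hρL⟩ := hφ.exists_radius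
    have hev := (ENNReal.tendsto_nhds_zero.1 hμ.tendsto_zero ε hε).and
      (Ioo_mem_nhdsGT hρ)
    obtain ⟨z, hzε, hz⟩ := hev.exists
    have hzL : ENNReal.ofReal z < L := (ENNReal.ofReal_le_ofReal hz.2.le).trans_lt hρL
    obtain ⟨r₀, hr₀, hloss⟩ := exists_lossModulus_le (u := u) (t := t) hφ hz.1 hzL
    filter_upwards [Ioo_mem_nhdsGT hr₀] with r hr
    refine le_trans ?_ hzε
    rw [← modulusAt_ofReal hz.1.le]
    exact modulusAt_mono hμ ((ENNReal.ofReal_pos.2 hr.1).trans_le (le_lossModulus hφ hr.1))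
      (hloss r hr.1 hr.2.le)

end Modulus

/-! ### Separation of trajectories and the modulus of the back-to-label map. -/

section Flow

variable {d : ℕ} {L : ℝ≥0∞} {m : ℝ} {φ : ℝ → ℝ}
  {u Φ : ℝ → EuclideanSpace ℝ (Fin d) → EuclideanSpace ℝ (Fin d)} {t : ℝ}

theorem IsOsgood.integrableOn_seminorm (hφ : IsOsgood L m φ) (hu : Measurable (Function.uncurry u))
    (hfin : ∀ t : ℝ, (∫⁻ s in Ioo 0 t, osgoodSeminorm L φ (u s)) ≠ ∞) (ht : 0 ≤ t) :
    IntervalIntegrable (fun s => (osgoodSeminorm L φ (u s)).toReal) volume 0 t := by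
  rw [intervalIntegrable_iff_integrableOn_Ioo_of_le ht]
  exact integrable_toReal_of_lintegral_ne_top (hφ.aemeasurable_osgoodSeminorm hu t) (hfin t)

theorem IsOsgood.ae_seminorm_lt_top (hφ : IsOsgood L m φ) (hu : Measurable (Function.uncurry u))
    (hfin : ∀ t : ℝ, (∫⁻ s in Ioo 0 t, osgoodSeminorm L φ (u s)) ≠ ∞) (t : ℝ) :
    ∀ᵐ s ∂(volume.restrict (Ioc 0 t)), osgoodSeminorm L φ (u s) < ∞ := by
  rw [← restrict_Ioo_eq_restrict_Ioc]
  exact ae_lt_top' (hφ.aemeasurable_osgoodSeminorm hu t) (hfin t)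

theorem IsOsgood.integral_seminorm (hφ : IsOsgood L m φ) (hu : Measurable (Function.uncurry u))
    (hfin : ∀ t : ℝ, (∫⁻ s in Ioo 0 t, osgoodSeminorm L φ (u s)) ≠ ∞) (ht : 0 ≤ t) :
    ∫ s in (0 : ℝ)..t, (osgoodSeminorm L φ (u s)).toReal = growth L φ u t := by
  rw [intervalIntegral.integral_of_le ht, integral_Ioc_eq_integral_Ioo, growth]
  exact integral_toReal (hφ.aemeasurable_osgoodSeminorm hu t)
    (ae_lt_top' (hφ.aemeasurable_osgoodSeminorm hu t) (hfin t))

theorem IsOsgood.norm_sub_le (hφ : IsOsgood L m φ)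
    {v : EuclideanSpace ℝ (Fin d) → EuclideanSpace ℝ (Fin d)} (hv : osgoodSeminorm L φ v < ∞)
    {ρ : ℝ} (hρL : ENNReal.ofReal ρ < L) {x y : EuclideanSpace ℝ (Fin d)} (hxy : ‖x - y‖ ≤ ρ) :
    ‖v x - v y‖ ≤ (osgoodSeminorm L φ v).toReal * cutModulus φ ρ ‖x - y‖ := by
  rcases eq_or_ne x y with rfl | hne
  · simp [cutModulus]
  have hpos : 0 < ‖x - y‖ := norm_pos_iff.2 (sub_ne_zero.2 hne)
  have hL : ENNReal.ofReal (dist x y) < L := by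
    rw [dist_eq_norm]; exact (ENNReal.ofReal_le_ofReal hxy).trans_lt hρL
  rw [cutModulus_of_mem hpos hxy, ← dist_eq_norm x y]
  have hφpos : 0 < φ (dist x y) := hφ.pos _ (dist_pos.2 hne) hL
  have h1 : ‖v x - v y‖ₑ / ENNReal.ofReal (φ (dist x y)) ≤ osgoodSeminorm L φ v :=
    le_iSup_of_le x (le_iSup₂_of_le y ⟨hne, hL⟩ le_rfl)
  have h2 : ‖v x - v y‖ₑ ≤ osgoodSeminorm L φ v * ENNReal.ofReal (φ (dist x y)) :=
    (ENNReal.div_le_iff (ENNReal.ofReal_pos.2 hφpos).ne' ENNReal.ofReal_ne_top).1 h1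
  have h3 := ENNReal.toReal_mono (ENNReal.mul_ne_top hv.ne ENNReal.ofReal_ne_top) h2
  rwa [ENNReal.toReal_mul, ENNReal.toReal_ofReal hφpos.le, toReal_enorm] at h3

namespace IsFlow

theorem intervalIntegrable (h : IsFlow u Φ) (x : EuclideanSpace ℝ (Fin d)) {s s' : ℝ}
    (hs : 0 ≤ s) (hs' : 0 ≤ s') : IntervalIntegrable (fun τ => u τ (Φ τ x)) volume s s' :=
  ((h x s hs).1.symm).trans (h x s' hs').1

theorem sub_eq (h : IsFlow u Φ) (x : EuclideanSpace ℝ (Fin d)) {s s' : ℝ}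
    (hs : 0 ≤ s) (hs' : 0 ≤ s') : Φ s' x - Φ s x = ∫ τ in s..s', u τ (Φ τ x) := by
  rw [(h x s hs).2, (h x s' hs').2, add_sub_add_left_eq_sub]
  exact intervalIntegral.integral_interval_sub_left (h x s' hs').1 (h x s hs).1

theorem continuousOn (h : IsFlow u Φ) (x : EuclideanSpace ℝ (Fin d)) (ht : 0 ≤ t) :
    ContinuousOn (fun s => Φ s x) (Icc 0 t) := by
  have h1 := intervalIntegral.continuousOn_primitive_interval
    ((intervalIntegrable_iff_integrableOn_Icc_of_le ht).1 (h x t ht).1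
      |>.mono_set (uIcc_of_le ht).subset)
  rw [uIcc_of_le ht] at h1
  exact (continuousOn_const.add h1).congr fun s hs => (h x s hs.1).2

theorem apply_zero (h : IsFlow u Φ) (x : EuclideanSpace ℝ (Fin d)) : Φ 0 x = x := by
  simpa using (h x 0 le_rfl).2

end IsFlow

/-- Two trajectories that stay within distance `ρ` on `[s, s']` separate at a rate that is
controlled by the modulus of continuity of the field. -/
theorem IsOsgood.abs_norm_sub_le (hφ : IsOsgood L m φ) (hu : Measurable (Function.uncurry u))
    (hfin : ∀ t : ℝ, (∫⁻ s in Ioo 0 t, osgoodSeminorm L φ (u s)) ≠ ∞) (hΦ : IsFlow u Φ)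
    {ρ : ℝ} (hρ : 0 < ρ) (hρL : ENNReal.ofReal ρ < L) (x y : EuclideanSpace ℝ (Fin d))
    {s s' : ℝ} (hs : 0 ≤ s) (hss : s ≤ s') (hnear : ∀ τ ∈ Icc s s', ‖Φ τ x - Φ τ y‖ ≤ ρ) :
    |‖Φ s' x - Φ s' y‖ - ‖Φ s x - Φ s y‖| ≤
      ∫ τ in s..s', (osgoodSeminorm L φ (u τ)).toReal * cutModulus φ ρ ‖Φ τ x - Φ τ y‖ := by
  have hs' := hs.trans hss
  refine (abs_norm_sub_norm_le _ _).trans ?_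
  have e : Φ s' x - Φ s' y - (Φ s x - Φ s y) =
      ∫ τ in s..s', (u τ (Φ τ x) - u τ (Φ τ y)) := by
    rw [intervalIntegral.integral_sub (hΦ.intervalIntegrable x hs hs')
      (hΦ.intervalIntegrable y hs hs'), ← hΦ.sub_eq x hs hs', ← hΦ.sub_eq y hs hs']
    abel
  rw [e]
  have hint := (hφ.cutModulus_mono hρ hρL).intervalIntegrable_mul_comp
    (hφ.cutModulus_nonneg hρ hρL) hs' (hφ.integrableOn_seminorm hu hfin hs')
    (((hΦ.continuousOn x hs').sub (hΦ.continuousOn y hs')).norm)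
  refine intervalIntegral.norm_integral_le_of_norm_le hss ?_
    (hint.mono_set (by rw [uIcc_of_le hss, uIcc_of_le hs']; exact Icc_subset_Icc_left hs))
  have hae := (ae_restrict_iff' measurableSet_Ioc).1 (hφ.ae_seminorm_lt_top hu hfin s')
  filter_upwards [hae] with τ hτ hmem
  exact hφ.norm_sub_le (hτ ⟨hs.trans_lt hmem.1, hmem.2⟩) hρL (hnear τ ⟨hmem.1.le, hmem.2⟩)

/-- The back-to-label map has the modulus of continuity `μ_{[u]_φ,t}`. -/
theorem IsFlow.ofReal_dist_le_lossModulus (hΦ : IsFlow u Φ) (hφ : IsOsgood L m φ)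
    (hu : Measurable (Function.uncurry u))
    (hfin : ∀ t : ℝ, (∫⁻ s in Ioo 0 t, osgoodSeminorm L φ (u s)) ≠ ∞)
    (ht : 0 ≤ t) {x y : EuclideanSpace ℝ (Fin d)} (hxy : Φ t x ≠ Φ t y) :
    ENNReal.ofReal (dist x y) ≤ lossModulus L m φ u t (dist (Φ t x) (Φ t y)) := by
  set r := dist (Φ t x) (Φ t y) with hr
  have hr0 : 0 < r := dist_pos.2 hxy
  rcases le_or_gt L (ENNReal.ofReal r) with hL | hL
  · rw [lossModulus_of_le hL]; exact le_top
  rw [lossModulus_of_lt hL]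
  -- `R⁻¹` is an infimum, so it is enough to compare `dist x y` with each admissible `z`.
  refine le_iInf₂ fun z ⟨hz, hzL, hzR⟩ => ENNReal.ofReal_le_ofReal ?_
  by_contra! hcon
  have hrz : r ≤ z := by
    refine (hφ.osgoodR_strictMonoOn.le_iff_le ⟨hr0, hL⟩ ⟨hz, hzL⟩).1 (le_trans ?_ hzR)
    have := Real.one_le_exp (growth_nonneg (L := L) (φ := φ) (u := u) (t := t))
    nlinarith [IsOsgood.osgoodR_pos m φ r]
  -- A level strictly above `z` is needed because `∫_r^z 1/φ` may equal the total growth; `∫_z^{z'}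
  -- 1/φ > 0` then gives the contradiction. It is kept below `L` because `dist x y` itself may lie
  -- outside the domain of `φ`.
  obtain ⟨z', hz', hzz', hz'd⟩ : ∃ z', ENNReal.ofReal z' < L ∧ z < z' ∧ z' ≤ dist x y := by
    have hev : ∀ᶠ w in 𝓝[>] z, ENNReal.ofReal w < L :=
      nhdsWithin_le_nhds (ENNReal.continuous_ofReal.continuousAt.eventually (gt_mem_nhds hzL))
    obtain ⟨w, hw, hw'⟩ := (hev.and (Ioo_mem_nhdsGT hcon)).exists
    exact ⟨w, hw, hw'.1, hw'.2.le⟩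
  have hz'0 := hz.trans hzz'
  have hft : ‖Φ t x - Φ t y‖ = r := (dist_eq_norm _ _).symm
  have hf0 : ‖Φ 0 x - Φ 0 y‖ = dist x y := by
    rw [hΦ.apply_zero, hΦ.apply_zero, dist_eq_norm]
  have key := osgood_level_le_backward (z := z') (f := fun s => ‖Φ s x - Φ s y‖)
    (hφ.cutModulus_mono hz'0 hz') (hφ.cutModulus_nonneg hz'0 hz') (hφ.cutModulus_pos hz'0 hz') ht
    (hφ.integrableOn_seminorm hu hfin ht) (fun s => ENNReal.toReal_nonneg)
    (((hΦ.continuousOn x ht).sub (hΦ.continuousOn y ht)).norm)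
    (by simpa only [hft] using hr0) (by simpa only [hft] using hrz.trans_lt hzz')
    (by simpa only [hf0] using hz'd) fun s hs hnear => by
      have := hφ.abs_norm_sub_le hu hfin hΦ hz'0 hz' x y hs.1 hs.2 hnear
      linarith [(abs_le.1 this).1]
  simp only [hft] at key
  rw [integral_one_div_cutModulus hr0 (hrz.trans hzz'.le) le_rfl,
    hφ.integral_seminorm hu hfin ht] at key
  rw [hφ.osgoodR_eq_mul hr0 hz hL hzL] at hzR
  have h1 := Real.exp_le_exp.1 (le_of_mul_le_mul_right hzR (IsOsgood.osgoodR_pos m φ r))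
  have h2 := hφ.integral_one_div_pos hz hzz' hz'.le
  have h3 := intervalIntegral.integral_add_adjacent_intervals
      (hφ.intervalIntegrable_one_div hr0 hz hL.le hzL.le)
      (hφ.intervalIntegrable_one_div hz hz'0 hzL.le hz'.le)
  linarith

/-- Trajectories that start close to each other stay close to each other. -/
theorem IsFlow.continuous (hΦ : IsFlow u Φ) (hφ : IsOsgood L m φ)
    (hu : Measurable (Function.uncurry u))
    (hfin : ∀ t : ℝ, (∫⁻ s in Ioo 0 t, osgoodSeminorm L φ (u s)) ≠ ∞)
    (ht : 0 ≤ t) : Continuous (Φ t) := by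
  refine Metric.continuous_iff.2 fun y ε hε => ?_
  obtain ⟨ρ₀, hρ₀, hρ₀L⟩ := hφ.exists_radius
  set ρ := min ρ₀ ε with hρdef
  have hρ : 0 < ρ := lt_min hρ₀ hε
  have hρL : ENNReal.ofReal ρ < L :=
    (ENNReal.ofReal_le_ofReal (min_le_left _ _)).trans_lt hρ₀L
  obtain ⟨a, ha, haρ, hB⟩ := hφ.exists_lt_integral (growth L φ u t) hρ hρL.le
  refine ⟨a, ha, fun x hx => ?_⟩
  by_contra! hcon
  have hne : x ≠ y := by
    rintro rfl
    rw [dist_self] at hcon; linarith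
  have hd : 0 < dist x y := dist_pos.2 hne
  have hf0 : ‖Φ 0 x - Φ 0 y‖ = dist x y := by
    rw [hΦ.apply_zero, hΦ.apply_zero, dist_eq_norm]
  have key := osgood_level_le (z := ρ) (f := fun s => ‖Φ s x - Φ s y‖)
    (hφ.cutModulus_mono hρ hρL) (hφ.cutModulus_nonneg hρ hρL) (hφ.cutModulus_pos hρ hρL) ht
    (hφ.integrableOn_seminorm hu hfin ht) (fun s => ENNReal.toReal_nonneg)
    (((hΦ.continuousOn x ht).sub (hΦ.continuousOn y ht)).norm)
    (by simpa only [hf0] using hd) (by simpa only [hf0] using hx.trans haρ)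
    (by simpa only [← dist_eq_norm] using (min_le_right _ _).trans hcon) fun s hs hnear => by
      have := hφ.abs_norm_sub_le hu hfin hΦ hρ hρL x y le_rfl hs.1 hnear
      linarith [(abs_le.1 this).2]
  simp only [hf0] at key
  rw [integral_one_div_cutModulus hd (hx.trans haρ).le le_rfl,
    hφ.integral_seminorm hu hfin ht] at key
  linarith [hB (dist x y) hd hx.le]

end Flow

/-! ### Jacobians of trace-free perturbations of the identity. -/

section Determinant

/-- The squared determinant is the product of the eigenvalues `λ ≥ 0` of `Mᵀ M`, and `λ ≤ exp (λ -
1)` for each of them. -/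
theorem Matrix.det_sq_le_exp_trace {n : Type*} [Fintype n] [DecidableEq n] (M : Matrix n n ℝ) :
    M.det ^ 2 ≤ Real.exp ((M.transpose * M).trace - Fintype.card n) := by
  have hps : (M.transpose * M).PosSemidef := by
    simpa using Matrix.posSemidef_conjTranspose_mul_self M
  have hH := hps.isHermitian
  have hdet : M.det ^ 2 = ∏ i, hH.eigenvalues i := by
    have := hH.det_eq_prod_eigenvalues
    rw [Matrix.det_mul, Matrix.det_transpose] at this
    rw [sq, this]; simp
  have htr : (M.transpose * M).trace = ∑ i, hH.eigenvalues i := by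
    have := hH.trace_eq_sum_eigenvalues
    simpa using this
  rw [hdet, htr]
  have : ∑ i, hH.eigenvalues i - Fintype.card n = ∑ i, (hH.eigenvalues i - 1) := by
    simp [Finset.sum_sub_distrib]
  rw [this, Real.exp_sum]
  refine Finset.prod_le_prod (fun i _ => hps.eigenvalues_nonneg i) fun i _ => ?_
  linarith [Real.add_one_le_exp (hH.eigenvalues i - 1)]

variable {d : ℕ}

/-- A vanishing trace removes the linear term of `tr ((1 + N)ᵀ (1 + N))`, so the bound is quadratic
in `‖A‖`. This gain makes the volume errors of many small steps negligible in total. -/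
theorem abs_det_one_add_le (A : EuclideanSpace ℝ (Fin d) →L[ℝ] EuclideanSpace ℝ (Fin d))
    (hA : LinearMap.trace ℝ _ (A : EuclideanSpace ℝ (Fin d) →ₗ[ℝ] EuclideanSpace ℝ (Fin d)) = 0) :
    |(ContinuousLinearMap.id ℝ _ + A).det| ≤ Real.exp ((d * ‖A‖) ^ 2) := by
  set e := (EuclideanSpace.basisFun (Fin d) ℝ).toBasis with he
  set N := LinearMap.toMatrix e e (A : EuclideanSpace ℝ (Fin d) →ₗ[ℝ] EuclideanSpace ℝ (Fin d))
    with hN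
  have hdet : (ContinuousLinearMap.id ℝ _ + A).det = (1 + N).det := by
    rw [ContinuousLinearMap.det, ← LinearMap.det_toMatrix e]
    congr 1
    simp [hN]
  have htrN : N.trace = 0 := by rw [← hA, LinearMap.trace_eq_matrix_trace ℝ e]
  have hentry : ∀ i j, N i j ^ 2 ≤ ‖A‖ ^ 2 := by
    intro i j
    have h1 : N i j = A (EuclideanSpace.single j 1) i := by
      simp [hN, LinearMap.toMatrix_apply, he]
    have h2 : ‖A (EuclideanSpace.single j 1)‖ ≤ ‖A‖ := by
      simpa using A.le_opNorm (EuclideanSpace.single j (1 : ℝ))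
    have h4 := PiLp.norm_apply_le (A (EuclideanSpace.single j (1 : ℝ))) i
    rw [h1, ← sq_abs]
    have : |A (EuclideanSpace.single j 1) i| ≤ ‖A‖ := h4.trans h2
    gcongr
  have htr : ((1 + N).transpose * (1 + N)).trace = d + ∑ i, ∑ j, N j i ^ 2 := by
    have : (1 + N).transpose * (1 + N) = 1 + N + N.transpose + N.transpose * N := by
      rw [Matrix.transpose_add, Matrix.transpose_one]; noncomm_ring
    rw [this, Matrix.trace_add, Matrix.trace_add, Matrix.trace_add, Matrix.trace_transpose, htrN,
      Matrix.trace_one]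
    simp [Matrix.trace, Matrix.mul_apply, sq]
  have hsq : (1 + N).det ^ 2 ≤ Real.exp ((d * ‖A‖) ^ 2) := by
    refine (Matrix.det_sq_le_exp_trace _).trans (Real.exp_le_exp.2 ?_)
    rw [htr, Fintype.card_fin, add_sub_cancel_left]
    calc ∑ i, ∑ j, N j i ^ 2 ≤ ∑ _i : Fin d, ∑ _j : Fin d, ‖A‖ ^ 2 :=
          Finset.sum_le_sum fun i _ => Finset.sum_le_sum fun j _ => hentry j i
      _ = (d * ‖A‖) ^ 2 := by simp; ring
  rw [hdet]
  have h1 : 1 ≤ Real.exp ((d * ‖A‖) ^ 2) := Real.one_le_exp (sq_nonneg _)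
  refine abs_le_of_sq_le_sq (hsq.trans ?_) (by positivity)
  nlinarith

end Determinant

/-! ### Mollification of divergence-free fields. -/

section Mollification

open scoped Convolution
open ContinuousLinearMap

variable {d : ℕ}

/-- The field `v` is divergence-free in the sense of distributions. -/
def DivFreeField (v : EuclideanSpace ℝ (Fin d) → EuclideanSpace ℝ (Fin d)) : Prop :=
  ∀ ψ : EuclideanSpace ℝ (Fin d) → ℝ, ContDiff ℝ ((⊤ : ℕ∞) : WithTop ℕ∞) ψ → HasCompactSupport ψ →
    ∫ x, fderiv ℝ ψ x (v x) = 0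

variable (η : ContDiffBump (0 : EuclideanSpace ℝ (Fin d)))
  {W : EuclideanSpace ℝ (Fin d) → EuclideanSpace ℝ (Fin d)}

/-- The convolution of the field `W` with a normalized bump function. -/
noncomputable def mollify (W : EuclideanSpace ℝ (Fin d) → EuclideanSpace ℝ (Fin d)) :
    EuclideanSpace ℝ (Fin d) → EuclideanSpace ℝ (Fin d) :=
  η.normed volume ⋆[lsmul ℝ ℝ, volume] W

/-- The derivative of the mollified field. -/
noncomputable def mollifyDeriv (W : EuclideanSpace ℝ (Fin d) → EuclideanSpace ℝ (Fin d)) :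
    EuclideanSpace ℝ (Fin d) → EuclideanSpace ℝ (Fin d) →L[ℝ] EuclideanSpace ℝ (Fin d) :=
  fderiv ℝ (η.normed volume) ⋆[(lsmul ℝ ℝ).precompL (EuclideanSpace ℝ (Fin d)), volume] W

theorem hasFDerivAt_mollify (hW : Continuous W) (x : EuclideanSpace ℝ (Fin d)) :
    HasFDerivAt (mollify η W) (mollifyDeriv η W x) x :=
  HasCompactSupport.hasFDerivAt_convolution_left (lsmul ℝ ℝ) η.hasCompactSupport_normed
    η.contDiff_normed hW.locallyIntegrable x

theorem mollifyDeriv_apply (x : EuclideanSpace ℝ (Fin d)) :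
    mollifyDeriv η W x =
      ∫ y, (fderiv ℝ (η.normed volume) y).smulRight (W (x - y)) := by
  rw [mollifyDeriv, convolution_def]
  rfl

theorem integrable_fderiv_normed_smulRight (hW : Continuous W) (x : EuclideanSpace ℝ (Fin d)) :
    Integrable fun y => (fderiv ℝ (η.normed volume) y).smulRight (W (x - y)) := by
  have h := η.hasCompactSupport_normed (μ := volume)
  have hc : Continuous (fderiv ℝ (η.normed volume)) :=
    (η.contDiff_normed (n := 1)).continuous_fderiv (by norm_num)
  refine Continuous.integrable_of_hasCompactSupport ?_ ?_
  · exact ((ContinuousLinearMap.smulRightL ℝ (EuclideanSpace ℝ (Fin d))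
      (EuclideanSpace ℝ (Fin d))).continuous.comp hc).clm_apply (by fun_prop)
  · refine (h.fderiv ℝ).mono fun y hy => ?_
    contrapose! hy
    simp only [Function.notMem_support] at hy ⊢
    rw [hy]; ext; simp

theorem norm_mollify_sub_le (hW : Continuous W) {c : ℝ}
    (hc : ∀ x y, ‖x - y‖ ≤ η.rOut → ‖W x - W y‖ ≤ c) (x : EuclideanSpace ℝ (Fin d)) :
    ‖mollify η W x - W x‖ ≤ c := by
  rw [← dist_eq_norm]
  refine ContDiffBump.dist_normed_convolution_le hW.aestronglyMeasurable fun y hy => ?_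
  rw [dist_eq_norm]
  exact hc y x (by rw [← dist_eq_norm]; exact (Metric.mem_ball.1 hy).le)

theorem mollifyDeriv_sub_const (hW : Continuous W) (x v : EuclideanSpace ℝ (Fin d)) :
    mollifyDeriv η (fun y => W y - v) x = mollifyDeriv η W x := by
  have hWv : Continuous fun y => W y - v := hW.sub continuous_const
  refine (hasFDerivAt_mollify η hWv x).unique ?_
  have : mollify η (fun y => W y - v) = fun x => mollify η W x - v := by
    ext1 x
    have hex : ConvolutionExists (η.normed volume) W (lsmul ℝ ℝ) volume :=
      η.hasCompactSupport_normed.convolutionExists_left _ η.continuous_normed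
        hW.locallyIntegrable
    have h1 := hex x
    unfold ConvolutionExistsAt at h1
    simp only [mollify, convolution_def, lsmul_apply, smul_sub] at h1 ⊢
    rw [integral_sub h1 (η.integrable_normed.smul_const v), integral_smul_const,
      η.integral_normed, one_smul]
  rw [this]
  exact (hasFDerivAt_mollify η hW x).sub_const v

/-- The derivative ignores additive constants, so `W x` may be subtracted first. Only the
oscillation of `W` at the scale of the bump enters, and `W` may be unbounded. -/
theorem norm_mollifyDeriv_le (hW : Continuous W) {c : ℝ}
    (hc : ∀ x y, ‖x - y‖ ≤ η.rOut → ‖W x - W y‖ ≤ c) (x : EuclideanSpace ℝ (Fin d)) :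
    ‖mollifyDeriv η W x‖ ≤ (∫ y, ‖fderiv ℝ (η.normed volume) y‖) * c := by
  rw [← mollifyDeriv_sub_const η hW x (W x), mollifyDeriv_apply, ← integral_mul_const]
  have hc1 : Continuous (fderiv ℝ (η.normed (volume : Measure (EuclideanSpace ℝ (Fin d))))) :=
    (η.contDiff_normed (n := 1)).continuous_fderiv (by norm_num)
  have hi : Integrable fun y => ‖fderiv ℝ (η.normed volume) y‖ * c :=
    ((hc1.integrable_of_hasCompactSupport (η.hasCompactSupport_normed.fderiv ℝ)).norm).mul_const c
  refine norm_integral_le_of_norm_le hi (Eventually.of_forall fun y => ?_)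
  rw [ContinuousLinearMap.norm_smulRight_apply]
  by_cases hy : y ∈ tsupport (η.normed (volume : Measure (EuclideanSpace ℝ (Fin d))))
  · rw [η.tsupport_normed_eq, mem_closedBall_zero_iff] at hy
    refine mul_le_mul_of_nonneg_left (hc _ _ ?_) (norm_nonneg _)
    simpa using hy
  · have : fderiv ℝ (η.normed (volume : Measure (EuclideanSpace ℝ (Fin d)))) y = 0 := by
      by_contra h
      exact hy (support_fderiv_subset ℝ h)
    simp [this]

theorem trace_smulRight (ℓ : EuclideanSpace ℝ (Fin d) →L[ℝ] ℝ) (v : EuclideanSpace ℝ (Fin d)) :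
    LinearMap.trace ℝ _ (ℓ.smulRight v : EuclideanSpace ℝ (Fin d) →ₗ[ℝ] EuclideanSpace ℝ (Fin d))
      = ℓ v := by
  exact LinearMap.trace_smulRight _ _

/-- The weak divergence condition is tested with the reflected, translated bump `y ↦ η (x - y)`. -/
theorem trace_mollifyDeriv (hW : Continuous W) (hdiv : DivFreeField W)
    (x : EuclideanSpace ℝ (Fin d)) :
    LinearMap.trace ℝ _
      (mollifyDeriv η W x : EuclideanSpace ℝ (Fin d) →ₗ[ℝ] EuclideanSpace ℝ (Fin d)) = 0 := by
  let tr : (EuclideanSpace ℝ (Fin d) →L[ℝ] EuclideanSpace ℝ (Fin d)) →L[ℝ] ℝ :=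
    LinearMap.toContinuousLinearMap ((LinearMap.trace ℝ (EuclideanSpace ℝ (Fin d))).comp
      (ContinuousLinearMap.coeLM ℝ))
  have htr : ∀ A, tr A = LinearMap.trace ℝ _
    (A : EuclideanSpace ℝ (Fin d) →ₗ[ℝ] EuclideanSpace ℝ (Fin d)) := fun A => rfl
  rw [← htr, mollifyDeriv_apply, ← tr.integral_comp_comm
    (integrable_fderiv_normed_smulRight η hW x)]
  simp only [htr, trace_smulRight]
  have h := hdiv (fun y => η.normed volume (x - y))
    (η.contDiff_normed.comp (contDiff_const.sub contDiff_id))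
    (η.hasCompactSupport_normed.comp_homeomorph (Homeomorph.subLeft x))
  have hder : ∀ y, fderiv ℝ (fun y => η.normed volume (x - y)) y
      = -fderiv ℝ (η.normed volume) (x - y) := by
    intro y
    have h1 : HasFDerivAt (η.normed volume) (fderiv ℝ (η.normed volume) (x - y)) (x - y) :=
      ((η.contDiff_normed (n := 1)).differentiable (by norm_num) _).hasFDerivAt
    have h2 := (h1.comp y ((hasFDerivAt_id y).const_sub x)).fderiv
    rw [Function.comp_def] at h2
    rw [h2]; ext; simp
  simp only [hder, neg_apply, integral_neg, neg_eq_zero] at h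
  rw [← h, ← integral_sub_left_eq_self _ volume x]
  simp

end Mollification

/-! ### One step: a surjection that almost does not increase volumes. -/

section StepMap

variable {d : ℕ}

/-- Banach's fixed point theorem for the contraction `x ↦ y - w x`. -/
theorem surjective_id_add_of_lipschitz {E : Type*} [NormedAddCommGroup E] [CompleteSpace E]
    {w : E → E} {κ : ℝ≥0} (hκ : κ < 1) (hw : LipschitzWith κ w) :
    Function.Surjective fun x => x + w x := by
  intro y
  have hc : ContractingWith κ fun x => y - w x :=
    ⟨hκ, by simpa using (LipschitzWith.const y).sub hw⟩
  have : Nonempty E := ⟨y⟩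
  refine ⟨hc.fixedPoint _, ?_⟩
  exact (sub_eq_iff_eq_add.1 hc.fixedPoint_isFixedPt).symm

/-- A divergence-free field that oscillates by at most `c` at scale `ε` is `c`-close to a smooth
field `w` for which `id + w` is onto and almost does not increase volumes. -/
theorem exists_volume_step (d : ℕ) {ε : ℝ} (hε : 0 < ε) :
    ∃ C : ℝ, 0 ≤ C ∧ ∀ (W : EuclideanSpace ℝ (Fin d) → EuclideanSpace ℝ (Fin d)) (c : ℝ),
      Continuous W → DivFreeField W → (∀ x y, ‖x - y‖ ≤ ε → ‖W x - W y‖ ≤ c) → C * c < 1 →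
      ∃ w : EuclideanSpace ℝ (Fin d) → EuclideanSpace ℝ (Fin d), Continuous w ∧
        (∀ x, ‖w x - W x‖ ≤ c) ∧ Function.Surjective (fun x => x + w x) ∧
        ∀ K : Set (EuclideanSpace ℝ (Fin d)), IsCompact K →
          volume ((fun x => x + w x) '' K) ≤ ENNReal.ofReal (Real.exp ((C * c) ^ 2)) * volume K := by
  let η : ContDiffBump (0 : EuclideanSpace ℝ (Fin d)) := ⟨ε / 2, ε, half_pos hε, half_lt_self hε⟩
  set D := ∫ y, ‖fderiv ℝ (η.normed volume) y‖ with hD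
  have hD0 : 0 ≤ D := integral_nonneg fun _ => norm_nonneg _
  -- With `D * c` bounding the derivative of the mollified field, the summand `d` serves the
  -- determinant estimate and the summand `1` makes the field a contraction.
  refine ⟨(d + 1) * D, by positivity, fun W c hW hdiv hc hlt => ?_⟩
  have hc0 : 0 ≤ c := (norm_nonneg _).trans (hc 0 0 (by simpa using hε.le))
  have hder := fun x => hasFDerivAt_mollify η hW x
  have hnorm : ∀ x, ‖mollifyDeriv η W x‖ ≤ D * c := norm_mollifyDeriv_le η hW hc
  have hlt1 : D * c < 1 := by
    refine lt_of_le_of_lt ?_ hlt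
    have : 0 ≤ (d : ℝ) * (D * c) := by positivity
    linarith
  have hlip : LipschitzWith ⟨D * c, by positivity⟩ (mollify η W) := by
    refine lipschitzWith_of_nnnorm_fderiv_le (𝕜 := ℝ) (fun x => (hder x).differentiableAt)
      fun x => ?_
    rw [(hder x).fderiv]
    exact hnorm x
  refine ⟨mollify η W, hlip.continuous, norm_mollify_sub_le η hW hc,
    surjective_id_add_of_lipschitz (κ := ⟨D * c, by positivity⟩) (by exact_mod_cast hlt1) hlip,
    fun K hK => ?_⟩
  -- An upper bound for the volume of the image needs no injectivity of the step.
  refine (addHaar_image_le_lintegral_abs_det_fderiv volume hK.measurableSet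
    (f' := fun x => ContinuousLinearMap.id ℝ _ + mollifyDeriv η W x)
    fun x _ => ((hasFDerivAt_id x).add (hder x)).hasFDerivWithinAt).trans ?_
  rw [← setLIntegral_const]
  refine lintegral_mono fun x => ENNReal.ofReal_le_ofReal ?_
  refine (abs_det_one_add_le _ (trace_mollifyDeriv η hW hdiv x)).trans (Real.exp_le_exp.2 ?_)
  have h1 : (d : ℝ) * ‖mollifyDeriv η W x‖ ≤ (d + 1) * D * c := by
    have := hnorm x
    have h2 : (d : ℝ) * ‖mollifyDeriv η W x‖ ≤ d * (D * c) := by gcongr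
    have : 0 ≤ D * c := by positivity
    linarith
  gcongr

end StepMap

/-! ### Fields with linear growth and their time integrals. -/

section TameField

variable {d : ℕ}

/-- `ψ` is a modulus of continuity that satisfies Osgood's condition on `(0, ρ]`. -/
structure OsgoodModulus (ψ : ℝ → ℝ) (ρ : ℝ) : Prop where
  radius_pos : 0 < ρ
  mono : Monotone ψ
  nonneg : ∀ r, 0 ≤ ψ r
  pos : ∀ r, 0 < r → 0 < ψ r
  zero : ψ 0 = 0
  continuousAt : ContinuousAt ψ 0
  diverges : ∀ B η : ℝ, 0 < η → η ≤ ρ → ∃ a, 0 < a ∧ a < η ∧ B < ∫ r in a..η, 1 / ψ r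

/-- A divergence-free field on `[0, t]` with linear growth and with modulus of continuity `ψ` at
scales up to `ρ`, both at the integrable rate `c`. -/
structure TameField (u : ℝ → EuclideanSpace ℝ (Fin d) → EuclideanSpace ℝ (Fin d)) (t : ℝ)
    (c ψ : ℝ → ℝ) (ρ : ℝ) : Prop where
  time_nonneg : 0 ≤ t
  measurable : Measurable (Function.uncurry u)
  osgood : OsgoodModulus ψ ρ
  rate_nonneg : ∀ s, 0 ≤ c s
  rate_integrable : IntervalIntegrable c volume 0 t
  growth : ∀ᵐ s ∂(volume.restrict (Ioc 0 t)), ∀ x, ‖u s x‖ ≤ c s * (1 + ‖x‖)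
  modulus : ∀ᵐ s ∂(volume.restrict (Ioc 0 t)), ∀ x y, ‖x - y‖ ≤ ρ →
    ‖u s x - u s y‖ ≤ c s * ψ ‖x - y‖
  divFree : ∀ᵐ s ∂(volume.restrict (Ioc 0 t)), DivFreeField (u s)

variable {u : ℝ → EuclideanSpace ℝ (Fin d) → EuclideanSpace ℝ (Fin d)} {t : ℝ} {c ψ : ℝ → ℝ}
  {ρ : ℝ}

namespace TameField

theorem rate_interval (h : TameField u t c ψ ρ) {s s' : ℝ} (hs : 0 ≤ s) (hss : s ≤ s')
    (hs' : s' ≤ t) : IntervalIntegrable c volume s s' :=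
  h.rate_integrable.mono_set (by
    rw [uIcc_of_le hss, uIcc_of_le h.time_nonneg]; exact Icc_subset_Icc hs hs')

theorem ae_interval {p : ℝ → Prop} (hp : ∀ᵐ s ∂(volume.restrict (Ioc 0 t)), p s) {s s' : ℝ}
    (hs : 0 ≤ s) (hs' : s' ≤ t) : ∀ᵐ τ ∂(volume.restrict (Ioc s s')), p τ :=
  ae_restrict_of_ae_restrict_of_subset (Ioc_subset_Ioc hs hs') hp

theorem intervalIntegrable (h : TameField u t c ψ ρ) (x : EuclideanSpace ℝ (Fin d)) {s s' : ℝ}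
    (hs : 0 ≤ s) (hss : s ≤ s') (hs' : s' ≤ t) :
    IntervalIntegrable (fun τ => u τ x) volume s s' := by
  have hc := h.rate_interval hs hss hs'
  rw [intervalIntegrable_iff_integrableOn_Ioc_of_le hss] at hc ⊢
  refine Integrable.mono' (hc.mul_const (1 + ‖x‖)) ?_ ?_
  · exact (h.measurable.comp measurable_prodMk_right).aestronglyMeasurable
  · filter_upwards [ae_interval h.growth hs hs'] with τ hτ using hτ x

/-- The field integrated over the time interval `[s, s']`. -/
noncomputable def _root_.timeIntegral
    (u : ℝ → EuclideanSpace ℝ (Fin d) → EuclideanSpace ℝ (Fin d)) (s s' : ℝ)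
    (x : EuclideanSpace ℝ (Fin d)) : EuclideanSpace ℝ (Fin d) := ∫ τ in s..s', u τ x

theorem norm_timeIntegral_le (h : TameField u t c ψ ρ) (x : EuclideanSpace ℝ (Fin d)) {s s' : ℝ}
    (hs : 0 ≤ s) (hss : s ≤ s') (hs' : s' ≤ t) :
    ‖timeIntegral u s s' x‖ ≤ (∫ τ in s..s', c τ) * (1 + ‖x‖) := by
  rw [← intervalIntegral.integral_mul_const]
  refine intervalIntegral.norm_integral_le_of_norm_le hss ?_
    ((h.rate_interval hs hss hs').mul_const _)
  have := (ae_restrict_iff' measurableSet_Ioc).1 (ae_interval h.growth hs hs')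
  filter_upwards [this] with τ hτ hmem using hτ hmem x

theorem norm_timeIntegral_sub_le (h : TameField u t c ψ ρ) {x y : EuclideanSpace ℝ (Fin d)}
    (hxy : ‖x - y‖ ≤ ρ) {s s' : ℝ} (hs : 0 ≤ s) (hss : s ≤ s') (hs' : s' ≤ t) :
    ‖timeIntegral u s s' x - timeIntegral u s s' y‖ ≤ (∫ τ in s..s', c τ) * ψ ‖x - y‖ := by
  unfold timeIntegral
  rw [← intervalIntegral.integral_mul_const, ← intervalIntegral.integral_sub
    (h.intervalIntegrable x hs hss hs') (h.intervalIntegrable y hs hss hs')]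
  refine intervalIntegral.norm_integral_le_of_norm_le hss ?_
    ((h.rate_interval hs hss hs').mul_const _)
  have := (ae_restrict_iff' measurableSet_Ioc).1 (ae_interval h.modulus hs hs')
  filter_upwards [this] with τ hτ hmem using hτ hmem x y hxy

theorem continuous_timeIntegral (h : TameField u t c ψ ρ) {s s' : ℝ}
    (hs : 0 ≤ s) (hss : s ≤ s') (hs' : s' ≤ t) : Continuous (timeIntegral u s s') := by
  refine continuous_iff_continuousAt.2 fun y => ?_
  rw [ContinuousAt, tendsto_iff_norm_sub_tendsto_zero]
  have h1 : Tendsto (fun x => ‖x - y‖) (𝓝 y) (𝓝 0) := by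
    have : Continuous fun x : EuclideanSpace ℝ (Fin d) => ‖x - y‖ := by fun_prop
    simpa using this.tendsto y
  have h2 : Tendsto (fun x => (∫ τ in s..s', c τ) * ψ ‖x - y‖) (𝓝 y) (𝓝 0) := by
    have := (h.osgood.continuousAt.tendsto.comp h1).const_mul (∫ τ in s..s', c τ)
    simpa [h.osgood.zero] using this
  refine squeeze_zero' (Eventually.of_forall fun _ => norm_nonneg _) ?_ h2
  filter_upwards [h1.eventually (ge_mem_nhds h.osgood.radius_pos)] with x hx
  exact h.norm_timeIntegral_sub_le hx hs hss hs'

/-- Fubini: the pairing with a test gradient is dominated by `‖fderiv ℝ f x‖ * (1 + ‖x‖) * c τ`,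
which is integrable thanks to the linear growth of the field. -/
theorem divFreeField_timeIntegral (h : TameField u t c ψ ρ) {s s' : ℝ}
    (hs : 0 ≤ s) (hss : s ≤ s') (hs' : s' ≤ t) : DivFreeField (timeIntegral u s s') := by
  intro f hf hfc
  have hcont : Continuous (fderiv ℝ f) := hf.continuous_fderiv (by simp)
  have hc := h.rate_interval hs hss hs'
  rw [intervalIntegrable_iff_integrableOn_Ioc_of_le hss] at hc
  have hg : Integrable fun x => ‖fderiv ℝ f x‖ * (1 + ‖x‖) := by
    refine Continuous.integrable_of_hasCompactSupport (by fun_prop) ?_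
    refine (hfc.fderiv ℝ).mono fun y hy => ?_
    contrapose! hy
    simp only [Function.notMem_support] at hy ⊢
    simp [hy]
  have hint : Integrable (Function.uncurry fun x τ => fderiv ℝ f x (u τ x))
      (volume.prod (volume.restrict (Ioc s s'))) := by
    refine Integrable.mono' (hg.mul_prod hc) ?_ ?_
    · have h1 : Measurable fun p : EuclideanSpace ℝ (Fin d) × ℝ => u p.2 p.1 :=
        h.measurable.comp measurable_swap
      have h2 : Measurable fun p : EuclideanSpace ℝ (Fin d) × ℝ => fderiv ℝ f p.1 :=
        hcont.measurable.comp measurable_fst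
      have h3 : Continuous fun q : (EuclideanSpace ℝ (Fin d) →L[ℝ] ℝ) ×
          EuclideanSpace ℝ (Fin d) => q.1 q.2 := by fun_prop
      exact (h3.measurable.comp (h2.prodMk h1)).aestronglyMeasurable
    · have := (Measure.quasiMeasurePreserving_snd
        (μ := (volume : Measure (EuclideanSpace ℝ (Fin d))))
        (ν := volume.restrict (Ioc s s'))).ae (ae_interval h.growth hs hs')
      filter_upwards [this] with p hp
      calc ‖fderiv ℝ f p.1 (u p.2 p.1)‖ ≤ ‖fderiv ℝ f p.1‖ * ‖u p.2 p.1‖ :=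
            ContinuousLinearMap.le_opNorm _ _
        _ ≤ ‖fderiv ℝ f p.1‖ * (c p.2 * (1 + ‖p.1‖)) := by gcongr; exact hp p.1
        _ = ‖fderiv ℝ f p.1‖ * (1 + ‖p.1‖) * c p.2 := by ring
  have e1 : ∀ x, fderiv ℝ f x (timeIntegral u s s' x) =
      ∫ τ in Ioc s s', fderiv ℝ f x (u τ x) := by
    intro x
    rw [timeIntegral, intervalIntegral.integral_of_le hss]
    refine ((fderiv ℝ f x).integral_comp_comm ?_).symm
    exact (intervalIntegrable_iff_integrableOn_Ioc_of_le hss).1 (h.intervalIntegrable x hs hss hs')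
  simp_rw [e1]
  rw [integral_integral_swap hint]
  refine integral_eq_zero_of_ae ?_
  filter_upwards [ae_interval h.divFree hs hs'] with τ hτ using hτ f hf hfc

end TameField

/-- A map that oscillates by at most `M` at scale `ρ` has linear growth. -/
theorem norm_sub_le_of_local {E F : Type*} [NormedAddCommGroup E] [NormedSpace ℝ E]
    [NormedAddCommGroup F] {v : E → F} {ρ M : ℝ} (hρ : 0 < ρ)
    (hv : ∀ x y, ‖x - y‖ ≤ ρ → ‖v x - v y‖ ≤ M) (x y : E) :
    ‖v x - v y‖ ≤ M * (1 + ‖x - y‖ / ρ) := by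
  have hM : 0 ≤ M := (norm_nonneg _).trans (hv 0 0 (by simpa using hρ.le))
  have key : ∀ n : ℕ, ∀ x y, ‖x - y‖ ≤ n * ρ → ‖v x - v y‖ ≤ n * M := by
    intro n
    induction n with
    | zero =>
      intro x y hxy
      have : x = y := by
        rw [← sub_eq_zero, ← norm_le_zero_iff]; simpa using hxy
      simp [this]
    | succ n ih =>
      intro x y hxy
      have hn : (0 : ℝ) < (n : ℝ) + 1 := by positivity
      push_cast at hxy ⊢
      have e1 : ‖x - (x + (1 / ((n : ℝ) + 1)) • (y - x))‖ ≤ ρ := by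
        rw [sub_add_cancel_left, norm_neg, norm_smul, norm_sub_rev y x,
          Real.norm_of_nonneg (by positivity), one_div_mul_eq_div, div_le_iff₀ hn]
        linarith
      have e2 : ‖x + (1 / ((n : ℝ) + 1)) • (y - x) - y‖ ≤ n * ρ := by
        have : x + (1 / ((n : ℝ) + 1)) • (y - x) - y = ((n : ℝ) / (n + 1)) • (x - y) := by
          have h1 : (n : ℝ) / (n + 1) = 1 - 1 / (n + 1) := by field_simp; ring
          rw [h1, sub_smul, one_smul, ← neg_sub x y, smul_neg]
          abel
        rw [this, norm_smul, Real.norm_of_nonneg (by positivity), div_mul_eq_mul_div,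
          div_le_iff₀ hn]
        have : (0 : ℝ) ≤ n := by positivity
        nlinarith
      have := norm_sub_le_norm_sub_add_norm_sub (v x) (v (x + (1 / ((n : ℝ) + 1)) • (y - x))) (v y)
      linarith [hv _ _ e1, ih _ _ e2]
  have h1 := key ⌈‖x - y‖ / ρ⌉₊ x y (by
    rw [← div_le_iff₀ hρ]; exact Nat.le_ceil _)
  have h2 := (Nat.ceil_lt_add_one (div_nonneg (norm_nonneg (x - y)) hρ.le)).le
  nlinarith

end TameField

/-! ### Osgood fields with a flow are tame. -/

section OsgoodField

variable {d : ℕ} {L : ℝ≥0∞} {m : ℝ} {φ : ℝ → ℝ}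
  {u Φ : ℝ → EuclideanSpace ℝ (Fin d) → EuclideanSpace ℝ (Fin d)} {t : ℝ}

theorem IsOsgood.osgoodModulus (hφ : IsOsgood L m φ) {ρ : ℝ} (hρ : 0 < ρ)
    (hρL : ENNReal.ofReal ρ < L) : OsgoodModulus (cutModulus φ ρ) ρ where
  radius_pos := hρ
  mono := hφ.cutModulus_mono hρ hρL
  nonneg := hφ.cutModulus_nonneg hρ hρL
  pos := hφ.cutModulus_pos hρ hρL
  zero := by simp [cutModulus]
  continuousAt := by
    have h0 : cutModulus φ ρ 0 = 0 := by simp [cutModulus]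
    rw [continuousAt_iff_continuous_left'_right']
    constructor
    · refine ContinuousWithinAt.congr (f := fun _ => (0 : ℝ)) continuousWithinAt_const ?_ h0
      intro r hr
      rw [cutModulus, if_pos (le_of_lt hr)]
    · rw [ContinuousWithinAt, h0]
      refine hφ.tendsto_zero.congr' ?_
      filter_upwards [Ioc_mem_nhdsGT hρ] with r hr
      rw [cutModulus_of_mem hr.1 hr.2]
  diverges := by
    intro B η hη hηρ
    obtain ⟨a, ha, haη, hB⟩ := hφ.exists_lt_integral B hη
      ((ENNReal.ofReal_le_ofReal hηρ).trans hρL.le)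
    refine ⟨a, ha, haη, ?_⟩
    rw [integral_one_div_cutModulus ha haη.le hηρ]
    exact hB a ha le_rfl

/-- A divergence-free Osgood field that has a flow is tame. -/
theorem IsOsgood.exists_tameField (hφ : IsOsgood L m φ) (hu : Measurable (Function.uncurry u))
    (hfin : ∀ t : ℝ, (∫⁻ s in Ioo 0 t, osgoodSeminorm L φ (u s)) ≠ ∞) (hdiv : IsDivFree u)
    (hΦ : IsFlow u Φ) (ht : 0 ≤ t) : ∃ c ψ ρ, TameField u t c ψ ρ := by
  obtain ⟨ρ, hρ, hρL⟩ := hφ.exists_radius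
  -- The seminorm says nothing about the size of `u`; its integrability in time is known only along
  -- trajectories. Growth is therefore measured from the trajectory of the origin, which stays in a
  -- ball of radius `R`.
  obtain ⟨R, hR⟩ := isCompact_Icc.exists_bound_of_continuousOn (hΦ.continuousOn 0 ht)
  have hR0 : 0 ≤ R := (norm_nonneg _).trans (hR 0 ⟨le_rfl, ht⟩)
  set ψ := cutModulus φ ρ with hψ
  have hosg := hφ.osgoodModulus hρ hρL
  set b : ℝ → ℝ := fun s => (osgoodSeminorm L φ (u s)).toReal with hb
  have hb0 : ∀ s, 0 ≤ b s := fun s => ENNReal.toReal_nonneg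
  have hψρ := hosg.nonneg ρ
  set Q : ℝ := ψ ρ * (1 + (1 + R) / ρ) with hQ
  have hQ0 : 0 ≤ Q := by positivity
  have hbint := hφ.integrableOn_seminorm hu hfin ht
  refine ⟨fun s => (‖u s (Φ s 0)‖ + b s * Q) + b s, ψ, ρ, ht, hu, hosg,
    fun s => add_nonneg (add_nonneg (norm_nonneg _) (mul_nonneg (hb0 s) hQ0)) (hb0 s),
    (((hΦ 0 t ht).1.norm).add (hbint.mul_const Q)).add hbint, ?_, ?_, ?_⟩
  · filter_upwards [hφ.ae_seminorm_lt_top hu hfin t, ae_restrict_mem measurableSet_Ioc]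
      with s hs hst x
    have h1 := norm_sub_le_of_local (v := u s) (M := b s * ψ ρ) hρ (fun x y hxy =>
      (hφ.norm_sub_le hs hρL hxy).trans
        (mul_le_mul_of_nonneg_left (hosg.mono hxy) (hb0 s))) x (Φ s 0)
    have h2 : ‖u s x‖ ≤ ‖u s (Φ s 0)‖ + ‖u s x - u s (Φ s 0)‖ := by
      have := norm_add_le (u s (Φ s 0)) (u s x - u s (Φ s 0))
      simpa using this
    have h3 : ‖x - Φ s 0‖ ≤ ‖x‖ + R := (_root_.norm_sub_le _ _).trans
      (by gcongr; exact hR s ⟨hst.1.le, hst.2⟩)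
    have h4 : 1 + ‖x - Φ s 0‖ / ρ ≤ (1 + (1 + R) / ρ) * (1 + ‖x‖) := by
      have : ‖x - Φ s 0‖ / ρ ≤ (1 + R) / ρ * (1 + ‖x‖) := by
        rw [div_mul_eq_mul_div]
        gcongr
        nlinarith [norm_nonneg x]
      nlinarith [norm_nonneg x]
    have h5 : b s * ψ ρ * (1 + ‖x - Φ s 0‖ / ρ) ≤ b s * Q * (1 + ‖x‖) := by
      have : 0 ≤ b s * ψ ρ := mul_nonneg (hb0 s) hψρ
      calc b s * ψ ρ * (1 + ‖x - Φ s 0‖ / ρ)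
          ≤ b s * ψ ρ * ((1 + (1 + R) / ρ) * (1 + ‖x‖)) := by gcongr
        _ = b s * Q * (1 + ‖x‖) := by rw [hQ]; ring
    have h6 : 0 ≤ ‖u s (Φ s 0)‖ * ‖x‖ := by positivity
    have h7 : 0 ≤ b s * (1 + ‖x‖) := mul_nonneg (hb0 s) (by positivity)
    nlinarith
  · filter_upwards [hφ.ae_seminorm_lt_top hu hfin t] with s hs x y hxy
    refine (hφ.norm_sub_le hs hρL hxy).trans ?_
    refine mul_le_mul_of_nonneg_right ?_ (hosg.nonneg _)
    have : 0 ≤ b s * Q := mul_nonneg (hb0 s) hQ0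
    linarith [norm_nonneg (u s (Φ s 0))]
  · exact ae_restrict_of_ae_restrict_of_subset Ioc_subset_Ioi_self hdiv

end OsgoodField

/-! ### Approximation of the flow by compositions of steps. -/

section Scheme

variable {d : ℕ} {u Φ : ℝ → EuclideanSpace ℝ (Fin d) → EuclideanSpace ℝ (Fin d)} {t : ℝ}
  {c ψ : ℝ → ℝ} {ρ : ℝ}

/-- The composition of the first `k` step maps `id + w j`. -/
def stepScheme (w : ℕ → EuclideanSpace ℝ (Fin d) → EuclideanSpace ℝ (Fin d)) :
    ℕ → EuclideanSpace ℝ (Fin d) → EuclideanSpace ℝ (Fin d)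
  | 0, x => x
  | k + 1, x => stepScheme w k x + w k (stepScheme w k x)

variable {w : ℕ → EuclideanSpace ℝ (Fin d) → EuclideanSpace ℝ (Fin d)} {N : ℕ}

theorem continuous_stepScheme (hw : ∀ k < N, Continuous (w k)) :
    ∀ k ≤ N, Continuous (stepScheme w k) := by
  intro k
  induction k with
  | zero => intro _; exact continuous_id
  | succ k ih =>
    intro hk
    have h := ih (by omega)
    exact h.add ((hw k (by omega)).comp h)

theorem surjective_stepScheme (hw : ∀ k < N, Function.Surjective fun x => x + w k x) :
    ∀ k ≤ N, Function.Surjective (stepScheme w k) := by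
  intro k
  induction k with
  | zero => intro _; exact Function.surjective_id
  | succ k ih =>
    intro hk
    exact (hw k (by omega)).comp (ih (by omega))

theorem volume_image_stepScheme_le {a : ℕ → ℝ} (hcont : ∀ k < N, Continuous (w k))
    (hw : ∀ k < N, ∀ K : Set (EuclideanSpace ℝ (Fin d)), IsCompact K →
      volume ((fun x => x + w k x) '' K) ≤ ENNReal.ofReal (Real.exp (a k)) * volume K)
    {K : Set (EuclideanSpace ℝ (Fin d))} (hK : IsCompact K) :
    ∀ k ≤ N, volume (stepScheme w k '' K) ≤
      ENNReal.ofReal (Real.exp (∑ j ∈ Finset.range k, a j)) * volume K := by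
  intro k
  induction k with
  | zero => intro _; simp [show stepScheme w 0 = id from rfl]
  | succ k ih =>
    intro hk
    have himg : stepScheme w (k + 1) '' K = (fun x => x + w k x) '' (stepScheme w k '' K) := by
      rw [image_image]; rfl
    rw [himg, Finset.sum_range_succ, Real.exp_add, mul_comm (Real.exp _),
      ENNReal.ofReal_mul (Real.exp_pos _).le, mul_assoc]
    refine (hw k (by omega) _ (hK.image (continuous_stepScheme hcont k (by omega)))).trans ?_
    gcongr
    exact ih (by omega)

/-- If every step has small linear growth, then the scheme pulls bounded sets back to bounded
sets. -/
theorem one_add_norm_le_stepScheme {β : ℕ → ℝ} (hβ0 : ∀ k < N, 0 ≤ β k)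
    (hβ : ∀ k < N, β k ≤ 1 / 2)
    (hw : ∀ k < N, ∀ x, ‖w k x‖ ≤ β k * (1 + ‖x‖)) (x : EuclideanSpace ℝ (Fin d)) :
    ∀ k ≤ N, 1 + ‖x‖ ≤ (1 + ‖stepScheme w k x‖) *
      Real.exp (2 * ∑ j ∈ Finset.range k, β j) := by
  intro k
  induction k with
  | zero => intro _; simp [stepScheme]
  | succ k ih =>
    intro hk
    have ih := ih (by omega)
    have hk' : k < N := by omega
    set z := stepScheme w k x
    have hz : stepScheme w (k + 1) x = z + w k z := rfl
    rw [hz, Finset.sum_range_succ, mul_add, Real.exp_add, mul_comm (Real.exp _), ← mul_assoc]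
    refine ih.trans (mul_le_mul_of_nonneg_right ?_ (Real.exp_pos _).le)
    have h1 : ‖z‖ ≤ ‖z + w k z‖ + ‖w k z‖ := by
      have := norm_sub_le (z + w k z) (w k z)
      simpa using this
    have h2 := hw k hk' z
    have h3 := hβ0 k hk'
    have h4 := hβ k hk'
    have h5 : (1 - β k) * (1 + ‖z‖) ≤ 1 + ‖z + w k z‖ := by linarith
    -- The factor `2` in the exponent comes from here: `1 / (1 - β) ≤ 1 + 2 β` for `0 ≤ β ≤ 1/2`.
    have h6 : 1 ≤ (1 - β k) * (1 + 2 * β k) := by nlinarith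
    have h7 : 1 + 2 * β k ≤ Real.exp (2 * β k) := by linarith [Real.add_one_le_exp (2 * β k)]
    have h8 : 0 ≤ 1 + ‖z‖ := by positivity
    calc 1 + ‖z‖ ≤ ((1 - β k) * (1 + 2 * β k)) * (1 + ‖z‖) := by nlinarith
      _ = ((1 - β k) * (1 + ‖z‖)) * (1 + 2 * β k) := by ring
      _ ≤ (1 + ‖z + w k z‖) * Real.exp (2 * β k) := by gcongr

namespace TameField

/-- Grönwall's inequality, obtained as the case `ψ r = max r 0` of Osgood's. -/
theorem one_add_norm_flow_le (h : TameField u t c ψ ρ) (hΦ : IsFlow u Φ)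
    (x : EuclideanSpace ℝ (Fin d)) {s : ℝ} (hs : s ∈ Icc 0 t) :
    1 + ‖Φ s x‖ ≤ (1 + ‖x‖) * Real.exp (∫ τ in (0 : ℝ)..t, c τ) := by
  have h0 : 1 + ‖Φ 0 x‖ = 1 + ‖x‖ := by rw [hΦ.apply_zero]
  have hcs := h.rate_interval le_rfl hs.1 hs.2
  have key := osgood_integral_le (ψ := fun r => max r 0) (f := fun s => 1 + ‖Φ s x‖)
    (fun a b hab => max_le_max_right 0 hab) (fun r => le_max_right _ _)
    (fun r hr => lt_max_of_lt_left hr) hs.1 hcs h.rate_nonneg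
    (continuousOn_const.add (hΦ.continuousOn x hs.1).norm)
    (by positivity) fun τ hτ => by
      have e := hΦ.sub_eq x le_rfl hτ.1
      have hτt := hτ.2.trans hs.2
      have hle : ‖Φ τ x - Φ 0 x‖ ≤ ∫ σ in (0 : ℝ)..τ, c σ * max (1 + ‖Φ σ x‖) 0 := by
        rw [e]
        refine intervalIntegral.norm_integral_le_of_norm_le hτ.1 ?_ ?_
        · filter_upwards [(ae_restrict_iff' measurableSet_Ioc).1
            (ae_interval h.growth le_rfl hτt)] with σ hσ hmem
          exact (hσ hmem _).trans (mul_le_mul_of_nonneg_left (le_max_left _ _) (h.rate_nonneg σ))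
        · exact Monotone.intervalIntegrable_mul_comp (ψ := fun r => max r 0)
            (fun a b hab => max_le_max_right 0 hab) (fun r => le_max_right _ _) hτ.1
            (h.rate_interval le_rfl hτ.1 hτt) (continuousOn_const.add (hΦ.continuousOn x hτ.1).norm)
      have := norm_sub_norm_le (Φ τ x) (Φ 0 x)
      linarith
  simp only [h0] at key
  have hx : 0 < 1 + ‖x‖ := by positivity
  have hy : 0 < 1 + ‖Φ s x‖ := by positivity
  have e : ∫ r in (1 + ‖x‖)..(1 + ‖Φ s x‖), 1 / max r 0 =
      Real.log ((1 + ‖Φ s x‖) / (1 + ‖x‖)) := by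
    rw [← integral_one_div_of_pos hx hy]
    refine intervalIntegral.integral_congr fun r hr => ?_
    have : 0 < r := lt_of_lt_of_le (lt_min hx hy) hr.1
    simp [max_eq_left this.le]
  rw [e] at key
  have hmono : ∫ τ in (0 : ℝ)..s, c τ ≤ ∫ τ in (0 : ℝ)..t, c τ :=
    intervalIntegral.integral_mono_interval le_rfl hs.1 hs.2
      (Eventually.of_forall h.rate_nonneg) h.rate_integrable
  have := (Real.log_le_iff_le_exp (by positivity)).1 (key.trans hmono)
  rwa [div_le_iff₀ hx, mul_comm] at this

/-- The recursive majorant of the error of the scheme. -/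
noncomputable def _root_.errorBound (ψ : ℝ → ℝ) (γ : ℕ → ℝ) (δ : ℝ) : ℕ → ℝ
  | 0 => δ
  | k + 1 => errorBound ψ γ δ k + 2 * γ k * ψ (errorBound ψ γ δ k)

theorem _root_.errorBound_mono {γ : ℕ → ℝ} {δ : ℝ} (hψ : ∀ r, 0 ≤ ψ r) (hγ : ∀ k, 0 ≤ γ k) :
    Monotone (errorBound ψ γ δ) := by
  refine monotone_nat_of_le_succ fun k => ?_
  have := mul_nonneg (mul_nonneg zero_le_two (hγ k)) (hψ (errorBound ψ γ δ k))
  simpa [errorBound] using this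

/-- A discrete Osgood inequality: between consecutive values `E k` and `E (k + 1)` of the majorant,
`1 / ψ ≤ 1 / ψ (E k)`, so each step contributes at most `2 γ k`. -/
theorem _root_.integral_errorBound_le {γ : ℕ → ℝ} {δ : ℝ} (hψm : Monotone ψ) (hψ : ∀ r, 0 ≤ ψ r)
    (hpos : ∀ r, 0 < r → 0 < ψ r) (hγ : ∀ k, 0 ≤ γ k) (hδ : 0 < δ) (k : ℕ) :
    ∫ r in δ..errorBound ψ γ δ k, 1 / ψ r ≤ 2 * ∑ j ∈ Finset.range k, γ j := by
  have hm := errorBound_mono (δ := δ) hψ hγ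
  have hF : ∀ k, 0 < errorBound ψ γ δ k := fun k => hδ.trans_le (hm (Nat.zero_le k))
  induction k with
  | zero => simp [errorBound]
  | succ k ih =>
    have e := intervalIntegral.integral_add_adjacent_intervals
      (hψm.intervalIntegrable_one_div hpos hδ (hF k))
      (hψm.intervalIntegrable_one_div hpos (hF k) (hF (k + 1)))
    rw [← e, Finset.sum_range_succ, mul_add]
    refine add_le_add ih ((hψm.integral_one_div_le hpos (hF k) (hm k.le_succ)).trans ?_)
    rw [div_le_iff₀ (hpos _ (hF k))]
    simp [errorBound]

theorem sum_rate_grid (h : TameField u t c ψ ρ) (hN : 0 < N) :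
    ∑ k ∈ Finset.range N, (∫ τ in gridPoint t N k..gridPoint t N (k + 1), c τ) =
      ∫ τ in (0 : ℝ)..t, c τ := by
  have := intervalIntegral.sum_integral_adjacent_intervals (f := c) (μ := volume)
    (a := gridPoint t N) (n := N) fun k hk =>
    h.rate_interval (gridPoint_mem h.time_nonneg hk.le).1
      (gridPoint_mono h.time_nonneg N k.le_succ) (gridPoint_mem h.time_nonneg hk).2
  rw [this, gridPoint_zero, gridPoint_self t hN]

/-- The scheme follows the flow. -/
theorem norm_stepScheme_sub_le (h : TameField u t c ψ ρ) (hΦ : IsFlow u Φ) {ε δ M : ℝ}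
    (γ : ℕ → ℝ)
    (hγ : ∀ k, γ k = ∫ τ in gridPoint t N k..gridPoint t N (k + 1), c τ) (hεδ : ε ≤ δ)
    {x : EuclideanSpace ℝ (Fin d)} (hM : ∀ s ∈ Icc 0 t, 1 + ‖Φ s x‖ ≤ M)
    (hMδ : ∀ k < N, γ k * M ≤ δ)
    (hw : ∀ k < N, ∀ x, ‖w k x - timeIntegral u (gridPoint t N k) (gridPoint t N (k + 1)) x‖ ≤
      γ k * ψ ε)
    (hρ : errorBound ψ γ δ N ≤ ρ) :
    ∀ k ≤ N, ‖stepScheme w k x - Φ (gridPoint t N k) x‖ + δ ≤ errorBound ψ γ δ k := by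
  have hgm := gridPoint_mono h.time_nonneg N
  have hγ0 : ∀ k, 0 ≤ γ k := fun k => by
    rw [hγ k]
    exact intervalIntegral.integral_nonneg (hgm k.le_succ) fun s _ => h.rate_nonneg s
  have hm := errorBound_mono (δ := δ) h.osgood.nonneg hγ0
  intro k
  induction k with
  | zero => intro _; simp [stepScheme, gridPoint_zero, hΦ.apply_zero, errorBound]
  | succ k ih =>
    intro hk
    have ih := ih (by omega)
    have hkN : k < N := by omega
    set s := gridPoint t N k
    set s' := gridPoint t N (k + 1)
    have hs : s ∈ Icc 0 t := gridPoint_mem h.time_nonneg hkN.le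
    have hs' : s' ∈ Icc 0 t := gridPoint_mem h.time_nonneg hk
    have hss : s ≤ s' := hgm k.le_succ
    set z := stepScheme w k x
    set F := errorBound ψ γ δ k
    have hFρ : F ≤ ρ := (hm hkN.le).trans hρ
    have hδF : δ ≤ F := hm (Nat.zero_le k)
    -- The slack `δ` carried in the induction absorbs the motion of the exact trajectory within one
    -- cell.
    have hdisp : ∀ τ ∈ Icc s s', ‖Φ τ x - Φ s x‖ ≤ δ := by
      intro τ hτ
      have hτt : τ ≤ t := hτ.2.trans hs'.2
      refine le_trans ?_ (hMδ k hkN)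
      have hM0 : 0 ≤ M := le_trans (by positivity) (hM s hs)
      rw [hΦ.sub_eq x hs.1 (hs.1.trans hτ.1)]
      have h1 : ‖∫ σ in s..τ, u σ (Φ σ x)‖ ≤ ∫ σ in s..τ, c σ * M := by
        refine intervalIntegral.norm_integral_le_of_norm_le hτ.1 ?_
          ((h.rate_interval hs.1 hτ.1 hτt).mul_const M)
        filter_upwards [(ae_restrict_iff' measurableSet_Ioc).1
            (ae_interval h.growth hs.1 hτt)] with σ hσ hmem
        exact (hσ hmem _).trans (mul_le_mul_of_nonneg_left
          (hM σ ⟨hs.1.trans hmem.1.le, hmem.2.trans hτt⟩) (h.rate_nonneg σ))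
      refine h1.trans ?_
      rw [intervalIntegral.integral_mul_const, hγ k]
      refine mul_le_mul_of_nonneg_right ?_ hM0
      exact intervalIntegral.integral_mono_interval le_rfl hτ.1 hτ.2
        (Eventually.of_forall h.rate_nonneg) (h.rate_interval hs.1 hss hs'.2)
    have hdiff : ‖∫ τ in s..s', (u τ z - u τ (Φ τ x))‖ ≤ γ k * ψ F := by
      rw [hγ k, ← intervalIntegral.integral_mul_const]
      refine intervalIntegral.norm_integral_le_of_norm_le hss ?_
        ((h.rate_interval hs.1 hss hs'.2).mul_const _)
      filter_upwards [(ae_restrict_iff' measurableSet_Ioc).1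
          (ae_interval h.modulus hs.1 hs'.2)] with τ hτ hmem
      have h1 : ‖z - Φ τ x‖ ≤ F := by
        have h2 := norm_sub_le_norm_sub_add_norm_sub z (Φ s x) (Φ τ x)
        rw [norm_sub_rev (Φ s x)] at h2
        linarith [hdisp τ ⟨hmem.1.le, hmem.2⟩]
      exact (hτ hmem z (Φ τ x) (h1.trans hFρ)).trans
        (mul_le_mul_of_nonneg_left (h.osgood.mono h1) (h.rate_nonneg τ))
    have e : stepScheme w (k + 1) x - Φ s' x = (z - Φ s x) + (w k z - timeIntegral u s s' z) +
        ∫ τ in s..s', (u τ z - u τ (Φ τ x)) := by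
      rw [intervalIntegral.integral_sub (h.intervalIntegrable z hs.1 hss hs'.2)
        (hΦ.intervalIntegrable x hs.1 hs'.1), ← hΦ.sub_eq x hs.1 hs'.1]
      change z + w k z - Φ s' x = _
      unfold timeIntegral
      abel
    rw [e]
    have h1 := norm_add₃_le (a := z - Φ s x) (b := w k z - timeIntegral u s s' z)
      (c := ∫ τ in s..s', (u τ z - u τ (Φ τ x)))
    have h2 := hw k hkN z
    have h3 : γ k * ψ ε ≤ γ k * ψ F :=
      mul_le_mul_of_nonneg_left (h.osgood.mono (hεδ.trans hδF)) (hγ0 k)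
    -- One copy of `γ k * ψ F` pays for replacing the time integral by `w k`, the other for
    -- evaluating `u` at `z` instead of along the trajectory.
    have h4 : errorBound ψ γ δ (k + 1) = F + 2 * γ k * ψ F := rfl
    linarith

/-- The flow at time `t` is approximated, uniformly on bounded sets, by maps that are onto and
almost do not increase volumes. -/
theorem exists_approximation (h : TameField u t c ψ ρ) (hΦ : IsFlow u Φ) :
    ∃ A : ℝ, ∀ R η : ℝ, 0 < η → η ≤ ρ →
      ∃ Ψ : EuclideanSpace ℝ (Fin d) → EuclideanSpace ℝ (Fin d), Function.Surjective Ψ ∧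
        (∀ x, 1 + ‖x‖ ≤ (1 + ‖Ψ x‖) * A) ∧ (∀ x, ‖x‖ ≤ R → ‖Ψ x - Φ t x‖ ≤ η) ∧
        ∀ K : Set (EuclideanSpace ℝ (Fin d)), IsCompact K →
          volume (Ψ '' K) ≤ ENNReal.ofReal (Real.exp η) * volume K := by
  set Γ := ∫ τ in (0 : ℝ)..t, c τ with hΓ
  have hΓ0 : 0 ≤ Γ := intervalIntegral.integral_nonneg h.time_nonneg fun s _ => h.rate_nonneg s
  set Q := 1 + ψ ρ with hQ
  have hQ0 : 0 < Q := by have := h.osgood.nonneg ρ; positivity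
  refine ⟨Real.exp (2 * (Γ * Q)), fun R η hη hηρ => ?_⟩
  set M := (1 + |R|) * Real.exp Γ with hM
  have hM0 : 0 < M := by positivity
  -- The scale `a` is both the mollification scale and the initial value of the error majorant.
  -- Climbing from `a` to `η` costs more than `2 Γ`, so the error stays below `η`. It is fixed
  -- before the grid, since the constant `C` of the step depends on it.
  obtain ⟨a, ha, haη, hdiv⟩ := h.osgood.diverges (2 * Γ) η hη hηρ
  obtain ⟨C, hC, hstep⟩ := exists_volume_step d ha
  set P := C * ψ a with hP
  have hψa := h.osgood.nonneg a
  have hP0 : 0 ≤ P := mul_nonneg hC hψa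
  -- The four bounds on the mass of a cell give, in order: displacement at most `a` (`hγ1`), small
  -- linear growth of the step (`hγ2`), the contraction condition (`hγ3`), and total volume error at
  -- most `η` (`hγ4`). The last one uses `∑ γ² ≤ (max γ) * Γ`.
  set δ := min (min (a / M) (1 / (2 * Q))) (min (1 / (2 * (P + 1))) (η / (P ^ 2 * Γ + 1))) with hδ
  have hδ0 : 0 < δ := by positivity
  obtain ⟨N, hN, hgrid⟩ := exists_grid_integral_le h.time_nonneg h.rate_integrable hδ0
  have hgm := gridPoint_mono h.time_nonneg N
  set γ : ℕ → ℝ := fun k => ∫ τ in gridPoint t N k..gridPoint t N (k + 1), c τ with hγ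
  have hγ0 : ∀ k, 0 ≤ γ k := fun k =>
    intervalIntegral.integral_nonneg (hgm k.le_succ) fun s _ => h.rate_nonneg s
  have hsum : ∑ k ∈ Finset.range N, γ k = Γ := h.sum_rate_grid hN
  have hγ1 : ∀ k < N, γ k * M ≤ a := fun k hk => by
    rw [← le_div_iff₀ hM0]
    exact (hgrid k hk).trans ((min_le_left _ _).trans (min_le_left _ _))
  have hγ2 : ∀ k < N, γ k * Q ≤ 1 / 2 := fun k hk => by
    have : γ k ≤ 1 / (2 * Q) := (hgrid k hk).trans ((min_le_left _ _).trans (min_le_right _ _))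
    rw [le_div_iff₀ (by positivity)] at this
    linarith
  have hγ3 : ∀ k < N, C * (γ k * ψ a) < 1 := fun k hk => by
    have : γ k ≤ 1 / (2 * (P + 1)) :=
      (hgrid k hk).trans ((min_le_right _ _).trans (min_le_left _ _))
    rw [le_div_iff₀ (by positivity)] at this
    have e : C * (γ k * ψ a) = γ k * P := by rw [hP]; ring
    rw [e]
    nlinarith [hγ0 k]
  have hγ4 : ∑ k ∈ Finset.range N, (C * (γ k * ψ a)) ^ 2 ≤ η := by
    calc ∑ k ∈ Finset.range N, (C * (γ k * ψ a)) ^ 2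
        ≤ ∑ k ∈ Finset.range N, P ^ 2 * (η / (P ^ 2 * Γ + 1)) * γ k := by
          refine Finset.sum_le_sum fun k hk => ?_
          have : γ k ≤ η / (P ^ 2 * Γ + 1) :=
            (hgrid k (Finset.mem_range.1 hk)).trans ((min_le_right _ _).trans (min_le_right _ _))
          have e : (C * (γ k * ψ a)) ^ 2 = P ^ 2 * γ k * γ k := by rw [hP]; ring
          rw [e]
          gcongr
          exact hγ0 k
      _ = P ^ 2 * (η / (P ^ 2 * Γ + 1)) * Γ := by rw [← Finset.mul_sum, hsum]
      _ = η * ((P ^ 2 * Γ) / (P ^ 2 * Γ + 1)) := by ring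
      _ ≤ η * 1 := by
          gcongr
          exact (div_le_one (by positivity)).2 (by linarith)
      _ = η := mul_one η
  have hex : ∀ k, ∃ w : EuclideanSpace ℝ (Fin d) → EuclideanSpace ℝ (Fin d), k < N →
      Continuous w ∧
      (∀ x, ‖w x - timeIntegral u (gridPoint t N k) (gridPoint t N (k + 1)) x‖ ≤ γ k * ψ a) ∧
      Function.Surjective (fun x => x + w x) ∧
      ∀ K : Set (EuclideanSpace ℝ (Fin d)), IsCompact K → volume ((fun x => x + w x) '' K) ≤
        ENNReal.ofReal (Real.exp ((C * (γ k * ψ a)) ^ 2)) * volume K := by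
    intro k
    by_cases hk : k < N
    · have hs := (gridPoint_mem h.time_nonneg hk.le).1
      have hs' := (gridPoint_mem h.time_nonneg (Nat.succ_le_of_lt hk)).2
      obtain ⟨w, hw⟩ := hstep _ (γ k * ψ a)
        (h.continuous_timeIntegral hs (hgm k.le_succ) hs')
        (h.divFreeField_timeIntegral hs (hgm k.le_succ) hs')
        (fun x y hxy => (h.norm_timeIntegral_sub_le (hxy.trans (haη.le.trans hηρ)) hs
          (hgm k.le_succ) hs').trans
          (mul_le_mul_of_nonneg_left (h.osgood.mono hxy) (hγ0 k))) (hγ3 k hk)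
      exact ⟨w, fun _ => hw⟩
    · exact ⟨id, fun hk' => absurd hk' hk⟩
  choose w hw using hex
  have herr : errorBound ψ γ a N ≤ η := by
    by_contra! hcon
    have h1 := integral_errorBound_le (δ := a) h.osgood.mono h.osgood.nonneg h.osgood.pos hγ0 ha N
    rw [hsum] at h1
    have e := intervalIntegral.integral_add_adjacent_intervals
      (h.osgood.mono.intervalIntegrable_one_div h.osgood.pos ha hη)
      (h.osgood.mono.intervalIntegrable_one_div h.osgood.pos hη (hη.trans hcon))
    have : 0 ≤ ∫ r in η..errorBound ψ γ a N, 1 / ψ r :=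
      intervalIntegral.integral_nonneg hcon.le fun r _ => one_div_nonneg.2 (h.osgood.nonneg r)
    linarith
  refine ⟨stepScheme w N, surjective_stepScheme (fun k hk => (hw k hk).2.2.1) N le_rfl,
    fun x => ?_, fun x hx => ?_, fun K hK => ?_⟩
  · have := one_add_norm_le_stepScheme (w := w) (N := N) (β := fun k => γ k * Q)
      (fun k _ => mul_nonneg (hγ0 k) hQ0.le) hγ2 (fun k hk x => ?_) x N le_rfl
    · rwa [← Finset.sum_mul, hsum] at this
    · have h1 := (hw k hk).2.1 x
      have h2 := h.norm_timeIntegral_le x (gridPoint_mem h.time_nonneg hk.le).1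
        (hgm k.le_succ) (gridPoint_mem h.time_nonneg (Nat.succ_le_of_lt hk)).2
      have h3 : ‖w k x‖ ≤ γ k * ψ a + γ k * (1 + ‖x‖) := by
        have := norm_add_le
          (w k x - timeIntegral u (gridPoint t N k) (gridPoint t N (k + 1)) x)
          (timeIntegral u (gridPoint t N k) (gridPoint t N (k + 1)) x)
        rw [sub_add_cancel] at this
        exact this.trans (add_le_add h1 h2)
      have h4 : ψ a ≤ ψ ρ * (1 + ‖x‖) := by
        have := h.osgood.mono (haη.le.trans hηρ)
        nlinarith [norm_nonneg x, h.osgood.nonneg ρ]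
      calc ‖w k x‖ ≤ γ k * (ψ a + (1 + ‖x‖)) := by linarith
        _ ≤ γ k * (ψ ρ * (1 + ‖x‖) + (1 + ‖x‖)) := by gcongr; exact hγ0 k
        _ = γ k * Q * (1 + ‖x‖) := by rw [hQ]; ring
  · have := h.norm_stepScheme_sub_le hΦ (w := w) (ε := a) (δ := a) (M := M) γ (fun k => rfl)
      le_rfl (x := x) (fun s hs => (h.one_add_norm_flow_le hΦ x hs).trans (by
        rw [hM]; gcongr; exact hx.trans (le_abs_self R))) hγ1 (fun k hk => (hw k hk).2.1)
      (herr.trans hηρ) N le_rfl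
    rw [gridPoint_self t hN] at this
    linarith
  · refine (volume_image_stepScheme_le (fun k hk => (hw k hk).1)
      (fun k hk => (hw k hk).2.2.2) hK N le_rfl).trans ?_
    gcongr

end TameField

end Scheme

/-! ### The flow map is a bijection that does not increase volumes. -/

section VolumePreservation

variable {d : ℕ} {L : ℝ≥0∞} {m : ℝ} {φ : ℝ → ℝ}
  {u Φ : ℝ → EuclideanSpace ℝ (Fin d) → EuclideanSpace ℝ (Fin d)} {t : ℝ}

namespace IsFlow

/-- Osgood's inequality needs a positive level to start from, so the distance is raised by a small
`a`. If two trajectories met at time `t`, the raised distance would climb backward from `a` to `ρ`,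
which costs more than the available growth. -/
theorem injective (hΦ : IsFlow u Φ) (hφ : IsOsgood L m φ) (hu : Measurable (Function.uncurry u))
    (hfin : ∀ t : ℝ, (∫⁻ s in Ioo 0 t, osgoodSeminorm L φ (u s)) ≠ ∞) (ht : 0 ≤ t) :
    Function.Injective (Φ t) := by
  intro x y hxy
  by_contra hne
  have hd : 0 < dist x y := dist_pos.2 hne
  obtain ⟨ρ₀, hρ₀, hρ₀L⟩ := hφ.exists_radius
  set ρ := min ρ₀ (dist x y) with hρdef
  have hρ : 0 < ρ := lt_min hρ₀ hd
  have hρL : ENNReal.ofReal ρ < L :=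
    (ENNReal.ofReal_le_ofReal (min_le_left _ _)).trans_lt hρ₀L
  obtain ⟨a, ha, haρ, hB⟩ := hφ.exists_lt_integral (growth L φ u t) hρ hρL.le
  set b : ℝ → ℝ := fun s => (osgoodSeminorm L φ (u s)).toReal
  have hmono := hφ.cutModulus_mono hρ hρL
  have hcont : ContinuousOn (fun s => ‖Φ s x - Φ s y‖) (Icc 0 t) :=
    ((hΦ.continuousOn x ht).sub (hΦ.continuousOn y ht)).norm
  have hb := hφ.integrableOn_seminorm hu hfin ht
  have hi1 := hmono.intervalIntegrable_mul_comp (hφ.cutModulus_nonneg hρ hρL) ht hb hcont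
  have hi2 := hmono.intervalIntegrable_mul_comp (hφ.cutModulus_nonneg hρ hρL) ht hb
    (hcont.add (continuousOn_const (c := a)))
  have hft : ‖Φ t x - Φ t y‖ = 0 := by rw [hxy, sub_self, norm_zero]
  have hf0 : ‖Φ 0 x - Φ 0 y‖ = dist x y := by
    rw [hΦ.apply_zero, hΦ.apply_zero, dist_eq_norm]
  have key := osgood_level_le_backward (z := ρ) (f := fun s => ‖Φ s x - Φ s y‖ + a)
    hmono (hφ.cutModulus_nonneg hρ hρL) (hφ.cutModulus_pos hρ hρL) ht hb
    (fun s => ENNReal.toReal_nonneg) (hcont.add continuousOn_const)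
    (by simpa only [hft, zero_add] using ha) (by simpa only [hft, zero_add] using haρ)
    (by simp only [hf0]; linarith [min_le_right ρ₀ (dist x y)]) fun s hs hnear => by
      have h1 := hφ.abs_norm_sub_le hu hfin hΦ hρ hρL x y hs.1 hs.2 fun τ hτ => by
        linarith [hnear τ hτ]
      have hsub : uIcc s t ⊆ uIcc 0 t := by
        rw [uIcc_of_le hs.2, uIcc_of_le ht]; exact Icc_subset_Icc_left hs.1
      have h2 : ∫ τ in s..t, b τ * cutModulus φ ρ ‖Φ τ x - Φ τ y‖ ≤
          ∫ τ in s..t, b τ * cutModulus φ ρ (‖Φ τ x - Φ τ y‖ + a) :=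
        intervalIntegral.integral_mono_on hs.2 (hi1.mono_set hsub) (hi2.mono_set hsub)
          fun τ _ => mul_le_mul_of_nonneg_left (hmono (by linarith)) ENNReal.toReal_nonneg
      linarith [(abs_le.1 h1).1]
  simp only [hft, zero_add] at key
  rw [integral_one_div_cutModulus ha haρ.le le_rfl, hφ.integral_seminorm hu hfin ht] at key
  linarith [hB a ha le_rfl]

/-- The back-to-label map is uniformly continuous. -/
theorem exists_dist_le (hΦ : IsFlow u Φ) (hφ : IsOsgood L m φ)
    (hu : Measurable (Function.uncurry u))
    (hfin : ∀ t : ℝ, (∫⁻ s in Ioo 0 t, osgoodSeminorm L φ (u s)) ≠ ∞) (ht : 0 ≤ t)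
    {ε : ℝ} (hε : 0 < ε) :
    ∃ δ, 0 < δ ∧ ∀ x y, dist (Φ t x) (Φ t y) ≤ δ → dist x y ≤ ε := by
  obtain ⟨ρ₀, hρ₀, hρ₀L⟩ := hφ.exists_radius
  obtain ⟨δ, hδ, hloss⟩ := exists_lossModulus_le (u := u) (t := t) hφ (lt_min hρ₀ hε)
    ((ENNReal.ofReal_le_ofReal (min_le_left ρ₀ ε)).trans_lt hρ₀L)
  refine ⟨δ, hδ, fun x y hxy => ?_⟩
  rcases eq_or_ne (Φ t x) (Φ t y) with h | h
  · rw [hΦ.injective hφ hu hfin ht h, dist_self]; exact hε.le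
  · have h1 := (hΦ.ofReal_dist_le_lossModulus hφ hu hfin ht h).trans
      (hloss _ (dist_pos.2 h) hxy)
    exact ((ENNReal.ofReal_le_ofReal_iff (lt_min hρ₀ hε).le).1 h1).trans (min_le_right _ _)

variable (hΦ : IsFlow u Φ) (hφ : IsOsgood L m φ) (hu : Measurable (Function.uncurry u))
  (hfin : ∀ t : ℝ, (∫⁻ s in Ioo 0 t, osgoodSeminorm L φ (u s)) ≠ ∞) (hdiv : IsDivFree u)
  (ht : 0 ≤ t)

include hΦ hφ hu hfin hdiv ht

/-- The approximations hit `y` exactly, at points confined to a fixed ball by the growth bound. A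
limit point of these is mapped to `y` by the continuous map `Φ t`. -/
theorem surjective : Function.Surjective (Φ t) := by
  intro y
  obtain ⟨c, ψ, ρ, h⟩ := hφ.exists_tameField hu hfin hdiv hΦ ht
  obtain ⟨A, hA⟩ := h.exists_approximation hΦ
  have hρ := h.osgood.radius_pos
  have happ : ∀ n : ℕ, ∃ x, ‖x‖ ≤ (1 + ‖y‖) * A ∧ ‖y - Φ t x‖ ≤ 1 / ((n : ℝ) + 1) := by
    intro n
    obtain ⟨Ψ, hΨs, hΨb, hΨa, -⟩ := hA ((1 + ‖y‖) * A) (min ρ (1 / ((n : ℝ) + 1)))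
      (by positivity) (min_le_left _ _)
    obtain ⟨x, rfl⟩ := hΨs y
    have hx : ‖x‖ ≤ (1 + ‖Ψ x‖) * A := by linarith [hΨb x]
    exact ⟨x, hx, (hΨa x hx).trans (min_le_right _ _)⟩
  choose x hxb hx using happ
  obtain ⟨z, -, κ, hκ, hlim⟩ := (isCompact_closedBall (0 : EuclideanSpace ℝ (Fin d))
    ((1 + ‖y‖) * A)).tendsto_subseq fun n => mem_closedBall_zero_iff.2 (hxb n)
  refine ⟨z, tendsto_nhds_unique (((hΦ.continuous hφ hu hfin ht).tendsto z).comp hlim) ?_⟩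
  have h0 : Tendsto (fun n => ‖y - Φ t (x n)‖) atTop (𝓝 0) :=
    squeeze_zero (fun _ => norm_nonneg _) hx tendsto_one_div_add_atTop_nhds_zero_nat
  have h1 : Tendsto (fun n => Φ t (x n)) atTop (𝓝 y) := by
    rw [tendsto_iff_norm_sub_tendsto_zero]
    simpa only [norm_sub_rev] using h0
  exact h1.comp hκ.tendsto_atTop

/-- Surjectivity of the approximation `Ψ` replaces a degree argument. A point `Φ t a` equals some `Ψ
x`; then `Φ t x` is close to `Φ t a`, and uniform continuity of the inverse puts `x` near `a`. So `Φ
t '' K` lies in the `Ψ`-image of a thickening of `K`, which shrinks to `K`. -/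
theorem volume_image_le {K : Set (EuclideanSpace ℝ (Fin d))} (hK : IsCompact K) :
    volume (Φ t '' K) ≤ volume K := by
  obtain ⟨c, ψ, ρ, h⟩ := hφ.exists_tameField hu hfin hdiv hΦ ht
  obtain ⟨A, hA⟩ := h.exists_approximation hΦ
  have hρ := h.osgood.radius_pos
  obtain ⟨R, hR⟩ := hK.exists_bound_of_continuousOn (hΦ.continuous hφ hu hfin ht).continuousOn
  have hA0 : 0 ≤ A := by
    obtain ⟨Ψ, -, hΨb, -, -⟩ := hA 0 ρ hρ le_rfl
    have h0 := hΨb 0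
    by_contra! hneg
    have : 0 < 1 + ‖Ψ 0‖ := by positivity
    have := norm_nonneg (0 : EuclideanSpace ℝ (Fin d))
    nlinarith
  have key : ∀ ε > 0, volume (Φ t '' K) ≤
      ENNReal.ofReal (Real.exp ε) * volume (Metric.cthickening ε K) := by
    intro ε hε
    obtain ⟨δ, hδ, hback⟩ := hΦ.exists_dist_le hφ hu hfin ht hε
    obtain ⟨Ψ, hΨs, hΨb, hΨa, hΨv⟩ := hA ((1 + R) * A) (min ρ (min ε δ))
      (by positivity) (min_le_left _ _)
    have hsub : Φ t '' K ⊆ Ψ '' Metric.cthickening ε K := by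
      rintro _ ⟨a, haK, rfl⟩
      obtain ⟨x, hx⟩ := hΨs (Φ t a)
      refine ⟨x, ?_, hx⟩
      have hxR : ‖x‖ ≤ (1 + R) * A := by
        have h1 := hΨb x
        rw [hx] at h1
        have h2 : (1 + ‖Φ t a‖) * A ≤ (1 + R) * A := by gcongr; exact hR a haK
        linarith
      have h1 := (hΨa x hxR).trans ((min_le_right _ _).trans (min_le_right _ _))
      rw [hx, ← dist_eq_norm] at h1
      exact Metric.mem_cthickening_of_dist_le x a ε K haK (by
        rw [dist_comm]; exact hback a x h1)
    refine (measure_mono hsub).trans ((hΨv _ hK.cthickening).trans ?_)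
    gcongr
    exact (min_le_right _ _).trans (min_le_left _ _)
  have hlim : Tendsto (fun ε => ENNReal.ofReal (Real.exp ε) * volume (Metric.cthickening ε K))
      (𝓝[>] 0) (𝓝 (volume K)) := by
    have h1 : Tendsto (fun ε => ENNReal.ofReal (Real.exp ε)) (𝓝 0) (𝓝 1) := by
      have := (ENNReal.continuous_ofReal.comp Real.continuous_exp).tendsto 0
      simpa [Function.comp_def] using this
    have h2 := ENNReal.Tendsto.mul h1 (Or.inl one_ne_zero)
      (tendsto_measure_cthickening_of_isCompact (μ := volume) hK) (Or.inr ENNReal.one_ne_top)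
    rw [one_mul] at h2
    exact h2.mono_left nhdsWithin_le_nhds
  refine ge_of_tendsto hlim ?_
  filter_upwards [self_mem_nhdsWithin] with ε hε using key ε hε

/-- The back-to-label map at time `t` exists, is continuous, and does not increase volumes. -/
theorem exists_inverse : ∃ Ξ : EuclideanSpace ℝ (Fin d) → EuclideanSpace ℝ (Fin d),
    (∀ x, Φ t (Ξ x) = x) ∧ Continuous Ξ ∧ Measure.map Ξ volume ≤ volume := by
  have hsurj := hΦ.surjective hφ hu hfin hdiv ht
  set Ξ := Function.surjInv hsurj
  have hright : ∀ x, Φ t (Ξ x) = x := Function.surjInv_eq hsurj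
  have hleft : ∀ x, Ξ (Φ t x) = x := fun x => hΦ.injective hφ hu hfin ht (hright _)
  have hcont : Continuous Ξ := by
    refine Metric.continuous_iff.2 fun y ε hε => ?_
    obtain ⟨δ, hδ, hback⟩ := hΦ.exists_dist_le hφ hu hfin ht (half_pos hε)
    refine ⟨δ, hδ, fun x hx => (hback _ _ ?_).trans_lt (half_lt_self hε)⟩
    rw [hright, hright]
    exact hx.le
  have hK : ∀ K : Set (EuclideanSpace ℝ (Fin d)), IsCompact K →
      Measure.map Ξ volume K ≤ volume K := by
    intro K hK
    rw [Measure.map_apply hcont.measurable hK.measurableSet]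
    have : Ξ ⁻¹' K = Φ t '' K := by
      ext x
      exact ⟨fun hx => ⟨Ξ x, hx, hright x⟩, by rintro ⟨y, hy, rfl⟩; simpa [hleft y] using hy⟩
    rw [this]
    exact hΦ.volume_image_le hφ hu hfin hdiv ht hK
  -- Finiteness on compact sets makes the push-forward regular, so that its value on open sets is
  -- determined by compact sets.
  have hfinK : IsFiniteMeasureOnCompacts (Measure.map Ξ volume) :=
    ⟨fun K hc => (hK K hc).trans_lt hc.measure_lt_top⟩
  refine ⟨Ξ, hright, hcont, Measure.le_iff.2 fun s _ => ?_⟩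
  rw [s.measure_eq_iInf_isOpen volume]
  refine le_iInf₂ fun U hU => le_iInf fun hUo => (measure_mono hU).trans ?_
  rw [hUo.measure_eq_iSup_isCompact]
  exact iSup₂_le fun K hKU => iSup_le fun hc => (hK K hc).trans (measure_mono hKU)

end IsFlow

end VolumePreservation

/-! ### Polar coordinates. -/

section Polar

variable {E : Type*} [NormedAddCommGroup E] [NormedSpace ℝ E] [FiniteDimensional ℝ E]
  [MeasurableSpace E] [BorelSpace E] [Nontrivial E]

/-- Polar coordinates for the Lebesgue integral of a radial function. -/
theorem lintegral_fun_norm_addHaar (μ : Measure E) [μ.IsAddHaarMeasure] {f : ℝ → ℝ≥0∞}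
    (hf : Measurable f) :
    ∫⁻ x, f ‖x‖ ∂μ = μ.toSphere univ *
      ∫⁻ r in Ioi (0 : ℝ), ENNReal.ofReal (r ^ (Module.finrank ℝ E - 1)) * f r := by
  calc ∫⁻ x, f ‖x‖ ∂μ = ∫⁻ x : ({(0)}ᶜ : Set E), f ‖x.1‖ ∂(μ.comap (↑)) := by
        rw [lintegral_subtype_comap (measurableSet_singleton _).compl fun x => f ‖x‖,
          restrict_compl_singleton]
    _ = ∫⁻ x, f x.2 ∂μ.toSphere.prod (.volumeIoiPow (Module.finrank ℝ E - 1)) := by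
        rw [← μ.measurePreserving_homeomorphUnitSphereProd.lintegral_comp_emb
          (Homeomorph.measurableEmbedding _)]
        simp
    _ = μ.toSphere univ *
        ∫⁻ r : Ioi (0 : ℝ), f r ∂.volumeIoiPow (Module.finrank ℝ E - 1) := by
        rw [lintegral_prod _ (by fun_prop)]
        simp [mul_comm]
    _ = _ := by
        rw [Measure.volumeIoiPow, lintegral_withDensity_eq_lintegral_mul _ (by fun_prop)
          (g := fun r : Ioi (0 : ℝ) => f r) (hf.comp measurable_subtype_coe)]
        congr 1
        exact lintegral_subtype_comap measurableSet_Ioi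
          fun r => ENNReal.ofReal (r ^ (Module.finrank ℝ E - 1)) * f r

/-- The integral over the unit ball of `f ‖h‖ / ‖h‖ ^ n`, where `n` is the dimension. -/
theorem lintegral_ball_div_norm_pow (μ : Measure E) [μ.IsAddHaarMeasure] {f : ℝ → ℝ≥0∞}
    (hf : MonotoneOn f (Ioi 0)) :
    ∫⁻ h in Metric.ball (0 : E) 1, f ‖h‖ / ‖h‖ₑ ^ Module.finrank ℝ E ∂μ =
      μ.toSphere univ * ∫⁻ r in Ioo (0 : ℝ) 1, f r / ENNReal.ofReal r := by
  set n := Module.finrank ℝ E with hn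
  have hnpos : 0 < n := Module.finrank_pos
  have hfm : Measurable ((Ioi (0 : ℝ)).indicator f) := hf.measurable_indicator ordConnected_Ioi
  set F : ℝ → ℝ≥0∞ := (Iio (1 : ℝ)).indicator fun r =>
    (Ioi (0 : ℝ)).indicator f r / ENNReal.ofReal r ^ n with hF
  have hFm : Measurable F :=
    (hfm.div (ENNReal.measurable_ofReal.pow_const n)).indicator measurableSet_Iio
  have e1 : ∫⁻ h in Metric.ball (0 : E) 1, f ‖h‖ / ‖h‖ₑ ^ n ∂μ = ∫⁻ h, F ‖h‖ ∂μ := by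
    rw [← lintegral_indicator measurableSet_ball]
    refine lintegral_congr_ae ?_
    have h0 : ∀ᵐ h ∂μ, h ≠ 0 := by
      rw [ae_iff]; simp
    filter_upwards [h0] with h hh
    have hpos : 0 < ‖h‖ := norm_pos_iff.2 hh
    by_cases hb : ‖h‖ < 1
    · rw [indicator_of_mem (mem_ball_zero_iff.2 hb), hF, indicator_of_mem (mem_Iio.2 hb),
        indicator_of_mem (mem_Ioi.2 hpos), ofReal_norm]
    · rw [indicator_of_notMem (by simpa using hb), hF, indicator_of_notMem (by simpa using hb)]
  rw [e1, lintegral_fun_norm_addHaar μ hFm]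
  congr 1
  rw [← lintegral_indicator measurableSet_Ioi, ← lintegral_indicator measurableSet_Ioo]
  refine lintegral_congr fun r => ?_
  by_cases h0 : 0 < r
  · rw [indicator_of_mem (mem_Ioi.2 h0)]
    by_cases h1 : r < 1
    · rw [indicator_of_mem (mem_Ioo.2 ⟨h0, h1⟩), hF, indicator_of_mem (mem_Iio.2 h1),
        indicator_of_mem (mem_Ioi.2 h0), ENNReal.ofReal_pow h0.le]
      have ha : ENNReal.ofReal r ^ (n - 1) ≠ 0 := pow_ne_zero _ (ENNReal.ofReal_pos.2 h0).ne'
      have ha' : ENNReal.ofReal r ^ (n - 1) ≠ ∞ := ENNReal.pow_ne_top ENNReal.ofReal_ne_top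
      obtain ⟨k, hk⟩ : ∃ k, n = k + 1 := ⟨n - 1, by omega⟩
      rw [← hn, hk, Nat.add_sub_cancel]
      rw [hk, Nat.add_sub_cancel] at ha ha'
      rw [pow_succ, div_eq_mul_inv, ENNReal.mul_inv (Or.inl ha) (Or.inl ha'), mul_left_comm,
        ← mul_assoc (ENNReal.ofReal r ^ k), ENNReal.mul_inv_cancel ha ha', one_mul,
        div_eq_mul_inv]
    · rw [indicator_of_notMem (fun h => h1 h.2), hF, indicator_of_notMem (by simpa using h1),
        mul_zero]
  · rw [indicator_of_notMem (by simpa using h0), indicator_of_notMem (fun h => h0 h.1)]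

end Polar

/-! ### Increments of the transported function. -/

section EnergyEstimate

variable {d : ℕ} {L : ℝ≥0∞} {m : ℝ} {φ : ℝ → ℝ}
  {u Φ : ℝ → EuclideanSpace ℝ (Fin d) → EuclideanSpace ℝ (Fin d)} {t : ℝ} {μ₀ : ℝ → ℝ≥0}

theorem modulus_dist_le_transportedModulus (hφ : IsOsgood L m φ)
    (hu : Measurable (Function.uncurry u))
    (hfin : ∀ t : ℝ, (∫⁻ s in Ioo 0 t, osgoodSeminorm L φ (u s)) ≠ ∞) (hΦ : IsFlow u Φ)
    (hμ : IsModulus fun r => (μ₀ r : ℝ≥0∞)) (ht : 0 ≤ t) {x y : EuclideanSpace ℝ (Fin d)}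
    (hxy : Φ t x ≠ Φ t y) :
    (μ₀ (dist x y) : ℝ≥0∞) ≤ transportedModulus L m φ u μ₀ t (dist (Φ t x) (Φ t y)) := by
  have hne : x ≠ y := fun h => hxy (by rw [h])
  rw [← modulusAt_ofReal dist_nonneg]
  exact modulusAt_mono hμ (ENNReal.ofReal_pos.2 (dist_pos.2 hne))
    (hΦ.ofReal_dist_le_lossModulus hφ hu hfin ht hxy)

theorem ENNReal.add_sq_le (a b : ℝ≥0∞) : (a + b) ^ 2 ≤ 4 * (a ^ 2 + b ^ 2) := by
  have h : a + b ≤ 2 * max a b := by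
    rw [two_mul]; exact add_le_add (le_max_left _ _) (le_max_right _ _)
  calc (a + b) ^ 2 ≤ (2 * max a b) ^ 2 := by gcongr
    _ = 4 * max a b ^ 2 := by rw [mul_pow]; norm_num
    _ ≤ 4 * (a ^ 2 + b ^ 2) := by
      gcongr
      rcases le_total a b with hab | hab
      · rw [max_eq_right hab]; exact le_add_self
      · rw [max_eq_left hab]; exact le_self_add

/-- For almost every `h`, the increment of `θ` in direction `h` is controlled pointwise
by the transported function `g`. -/
theorem ae_enorm_sub_le (hφ : IsOsgood L m φ) (hu : Measurable (Function.uncurry u))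
    (hfin : ∀ t : ℝ, (∫⁻ s in Ioo 0 t, osgoodSeminorm L φ (u s)) ≠ ∞) (hΦ : IsFlow u Φ)
    (hμ : IsModulus fun r => (μ₀ r : ℝ≥0∞)) (ht : 0 ≤ t)
    {θ₀ : EuclideanSpace ℝ (Fin d) → ℝ} {θ : ℝ → EuclideanSpace ℝ (Fin d) → ℝ}
    (hθ : IsTransported Φ θ₀ θ) {g : EuclideanSpace ℝ (Fin d) → ℝ}
    (hg : ∀ᵐ p : EuclideanSpace ℝ (Fin d) × EuclideanSpace ℝ (Fin d),
      |θ₀ p.1 - θ₀ p.2| ≤ (g p.1 + g p.2) * μ₀ (dist p.1 p.2))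
    {Ξ : EuclideanSpace ℝ (Fin d) → EuclideanSpace ℝ (Fin d)} (hΞ : ∀ x, Φ t (Ξ x) = x)
    (hΞq : Measure.QuasiMeasurePreserving Ξ volume volume) :
    ∀ᵐ h : EuclideanSpace ℝ (Fin d), ∀ᵐ x : EuclideanSpace ℝ (Fin d), h ≠ 0 →
      ‖θ t x - θ t (x + h)‖ₑ ≤
        (‖g (Ξ x)‖ₑ + ‖g (Ξ (x + h))‖ₑ) * transportedModulus L m φ u μ₀ t ‖h‖ := by
  let E := EuclideanSpace ℝ (Fin d)
  have hΞ2 : Measure.QuasiMeasurePreserving (Prod.map Ξ Ξ) (volume : Measure (E × E))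
      (volume : Measure (E × E)) := by
    refine ⟨hΞq.measurable.prodMap hΞq.measurable, ?_⟩
    rw [Measure.volume_eq_prod, ← Measure.map_prod_map _ _ hΞq.measurable hΞq.measurable]
    exact hΞq.absolutelyContinuous.prod hΞq.absolutelyContinuous
  have h1 : ∀ᵐ p : E × E, |θ₀ (Ξ p.1) - θ₀ (Ξ p.2)| ≤
      (g (Ξ p.1) + g (Ξ p.2)) * μ₀ (dist (Ξ p.1) (Ξ p.2)) :=
    hΞ2.ae hg
  -- The shear `(h, x) ↦ (x, x + h)` preserves measure, so almost every pair of points becomes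
  -- almost every displacement `h` together with almost every base point `x`.
  have h2 : ∀ᵐ p : E × E, |θ₀ (Ξ p.2) - θ₀ (Ξ (p.2 + p.1))| ≤
      (g (Ξ p.2) + g (Ξ (p.2 + p.1))) * μ₀ (dist (Ξ p.2) (Ξ (p.2 + p.1))) :=
    ((measurePreserving_prod_add (volume : Measure E) (volume : Measure E)).comp
      Measure.measurePreserving_swap).quasiMeasurePreserving.ae h1
  filter_upwards [Measure.ae_ae_of_ae_prod h2] with h hh
  filter_upwards [hh] with x hx hne
  have e1 : ∀ y, θ t y = θ₀ (Ξ y) := fun y => by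
    have := hθ t ht (Ξ y)
    rwa [hΞ] at this
  have hdist : dist x (x + h) = ‖h‖ := by simp [dist_eq_norm]
  have hw := modulus_dist_le_transportedModulus hφ hu hfin hΦ hμ ht (x := Ξ x) (y := Ξ (x + h))
    (by rw [hΞ, hΞ]; simpa using hne)
  rw [hΞ, hΞ, hdist] at hw
  rw [e1, e1]
  calc ‖θ₀ (Ξ x) - θ₀ (Ξ (x + h))‖ₑ
      ≤ ‖(g (Ξ x) + g (Ξ (x + h))) * (μ₀ (dist (Ξ x) (Ξ (x + h))) : ℝ)‖ₑ := by
        rw [enorm_le_iff_norm_le, Real.norm_eq_abs]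
        exact hx.trans (le_abs_self _)
    _ = ‖g (Ξ x) + g (Ξ (x + h))‖ₑ * (μ₀ (dist (Ξ x) (Ξ (x + h))) : ℝ≥0∞) := by
        rw [enorm_mul]; simp
    _ ≤ _ := by
        gcongr
        exact enorm_add_le _ _

/-- One of the two factors `w` from the square cancels against the weight; `w * w⁻¹ ≤ 1` covers the
value `∞` as well. The constant is `4` from squaring a sum, doubled by translation invariance. -/
theorem lintegral_increment_le {f G : EuclideanSpace ℝ (Fin d) → ℝ≥0∞} (hG : AEMeasurable G)
    {h : EuclideanSpace ℝ (Fin d)} {w b : ℝ≥0∞}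
    (hf : ∀ᵐ x, f x ≤ (G x + G (x + h)) * w) :
    ∫⁻ x, f x ^ 2 / b * w⁻¹ ≤ 8 * (∫⁻ x, G x ^ 2) * (w / b) := by
  have hpt : ∀ᵐ x, f x ^ 2 / b * w⁻¹ ≤ 4 * (G x ^ 2 + G (x + h) ^ 2) * (w / b) := by
    filter_upwards [hf] with x hx
    calc f x ^ 2 / b * w⁻¹ ≤ ((G x + G (x + h)) * w) ^ 2 / b * w⁻¹ := by gcongr
      _ = (G x + G (x + h)) ^ 2 * ((w / b) * (w * w⁻¹)) := by
          rw [div_eq_mul_inv, div_eq_mul_inv]; ring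
      _ ≤ 4 * (G x ^ 2 + G (x + h) ^ 2) * ((w / b) * 1) := by
          gcongr
          · exact ENNReal.add_sq_le _ _
          · exact ENNReal.mul_inv_le_one w
      _ = _ := by rw [mul_one]
  have hG2 : AEMeasurable (fun x => G x ^ 2) := hG.pow_const 2
  have hGh : AEMeasurable (fun x => G (x + h) ^ 2) :=
    hG2.comp_quasiMeasurePreserving (measurePreserving_add_right volume h).quasiMeasurePreserving
  calc ∫⁻ x, f x ^ 2 / b * w⁻¹ ≤ ∫⁻ x, 4 * (G x ^ 2 + G (x + h) ^ 2) * (w / b) :=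
        lintegral_mono_ae hpt
    _ = 4 * (∫⁻ x, G x ^ 2 + G (x + h) ^ 2) * (w / b) := by
        have hsum : AEMeasurable fun x => G x ^ 2 + G (x + h) ^ 2 := hG2.add hGh
        rw [lintegral_mul_const'' _ (hsum.const_mul 4), lintegral_const_mul'' _ hsum]
    _ = 8 * (∫⁻ x, G x ^ 2) * (w / b) := by
        rw [lintegral_add_left' hG2, lintegral_add_right_eq_self (fun x => G x ^ 2) h]
        ring

/-- The place where the volume bound enters: changing variables by `Ξ` costs no constant. -/
theorem lintegral_enorm_comp_sq_le {g : EuclideanSpace ℝ (Fin d) → ℝ} (hg : MemLp g 2 volume)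
    {Ξ : EuclideanSpace ℝ (Fin d) → EuclideanSpace ℝ (Fin d)} (hΞ : Measurable Ξ)
    (hle : Measure.map Ξ volume ≤ volume) :
    ∫⁻ x, ‖g (Ξ x)‖ₑ ^ 2 ≤ eLpNorm g 2 volume ^ 2 := by
  have hg2 : AEMeasurable (fun x => ‖g x‖ₑ ^ 2) := hg.1.enorm.pow_const 2
  have e : eLpNorm g 2 volume ^ 2 = ∫⁻ x, ‖g x‖ₑ ^ 2 := by
    have := eLpNorm_nnreal_pow_eq_lintegral (f := g) (μ := volume) (p := 2) (by norm_num)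
    simpa using this
  rw [e, ← lintegral_map' (hg2.mono_measure hle) hΞ.aemeasurable]
  exact lintegral_mono' hle le_rfl

end EnergyEstimate

theorem theorem1p2 (d : ℕ) :
    ∃ C : ℝ≥0, ∀ (L : ℝ≥0∞) (m : ℝ) (φ : ℝ → ℝ)
      (u Φ : ℝ → EuclideanSpace ℝ (Fin d) → EuclideanSpace ℝ (Fin d))
      (μ₀ : ℝ → ℝ≥0)
      (θ₀ : EuclideanSpace ℝ (Fin d) → ℝ) (θ : ℝ → EuclideanSpace ℝ (Fin d) → ℝ),
      IsOsgood L m φ →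
      Measurable (Function.uncurry u) →
      (∀ t : ℝ, (∫⁻ s in Ioo 0 t, osgoodSeminorm L φ (u s)) ≠ ∞) →
      IsDivFree u →
      IsFlow u Φ →
      IsModulus (fun r => (μ₀ r : ℝ≥0∞)) →
      IsTransported Φ θ₀ θ →
      (∀ K : ℝ≥0, HasModulus K (fun r => (μ₀ r : ℝ≥0∞)) θ₀ →
        ∀ t : ℝ, 0 ≤ t →
          IsModulus (transportedModulus L m φ u μ₀ t) ∧
            HasModulus K (transportedModulus L m φ u μ₀ t) (θ t)) ∧
      (∀ T : ℝ, 0 < T → diniIntegral L m φ u μ₀ T < ∞ →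
        AEMeasurable θ₀ volume →
        ∀ g : EuclideanSpace ℝ (Fin d) → ℝ, MemLp g 2 volume →
          (∀ᵐ p : EuclideanSpace ℝ (Fin d) × EuclideanSpace ℝ (Fin d),
            |θ₀ p.1 - θ₀ p.2| ≤ (g p.1 + g p.2) * μ₀ (dist p.1 p.2)) →
          ∀ t ∈ Icc 0 T,
            ∫⁻ h in Metric.ball (0 : EuclideanSpace ℝ (Fin d)) 1,
                ∫⁻ x : EuclideanSpace ℝ (Fin d),
                  ‖θ t x - θ t (x + h)‖ₑ ^ 2 / ‖h‖ₑ ^ d *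
                    (transportedModulus L m φ u μ₀ t ‖h‖)⁻¹
              ≤ C * eLpNorm g 2 volume ^ 2 * diniIntegral L m φ u μ₀ T) := by
  -- The factor `8` is that of `lintegral_increment_le`; the area of the unit sphere comes from
  -- polar coordinates.
  refine ⟨8 * (Measure.toSphere (volume : Measure (EuclideanSpace ℝ (Fin d))) univ).toNNReal,
    fun L m φ u Φ μ₀ θ₀ θ hφ hu hfin hdiv hΦ hμ hθ => ⟨fun K hK t ht => ?_, ?_⟩⟩
  · refine ⟨isModulus_transportedModulus hφ hμ, fun x y hxy => ?_⟩
    obtain ⟨a, rfl⟩ := hΦ.surjective hφ hu hfin hdiv ht x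
    obtain ⟨b, rfl⟩ := hΦ.surjective hφ hu hfin hdiv ht y
    have hab : a ≠ b := fun h => hxy (by rw [h])
    rw [hθ t ht, hθ t ht]
    refine (hK a b hab).trans ?_
    gcongr
    exact modulus_dist_le_transportedModulus hφ hu hfin hΦ hμ ht hxy
  · intro T hT _ _ g hg hbound t ht
    -- Polar coordinates require a nontrivial space; in dimension `0` all increments vanish.
    rcases Nat.eq_zero_or_pos d with rfl | hd
    · refine le_of_eq_of_le ?_ zero_le
      simp [Subsingleton.elim _ (0 : EuclideanSpace ℝ (Fin 0))]
    have : Nonempty (Fin d) := ⟨⟨0, hd⟩⟩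
    obtain ⟨Ξ, hΞ, hΞc, hΞle⟩ := hΦ.exists_inverse hφ hu hfin hdiv ht.1
    have hΞq : Measure.QuasiMeasurePreserving Ξ volume volume :=
      ⟨hΞc.measurable, hΞle.absolutelyContinuous⟩
    have hG : AEMeasurable fun x => ‖g (Ξ x)‖ₑ :=
      hg.1.enorm.comp_quasiMeasurePreserving hΞq
    set S := Measure.toSphere (volume : Measure (EuclideanSpace ℝ (Fin d))) univ with hS
    set w := transportedModulus L m φ u μ₀ with hw
    have hfinrank : Module.finrank ℝ (EuclideanSpace ℝ (Fin d)) = d := by simp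
    have hne : ∀ᵐ h : EuclideanSpace ℝ (Fin d), h ≠ 0 := by
      rw [ae_iff]; simp
    calc _ ≤ ∫⁻ h in Metric.ball (0 : EuclideanSpace ℝ (Fin d)) 1,
          8 * eLpNorm g 2 volume ^ 2 * (w T ‖h‖ / ‖h‖ₑ ^ d) := by
          refine lintegral_mono_ae (ae_restrict_of_ae ?_)
          filter_upwards [hne, ae_enorm_sub_le hφ hu hfin hΦ hμ ht.1 hθ hbound hΞ hΞq] with h h0 hh
          refine (lintegral_increment_le hG (by filter_upwards [hh] with x hx using hx h0)).trans ?_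
          gcongr
          · exact lintegral_enorm_comp_sq_le hg hΞc.measurable hΞle
          -- The modulus left over at time `t` is bounded by the one at time `T`, whose Dini
          -- integral is the given one.
          · exact transportedModulus_mono_time hφ hμ hfin ht.2 (norm_pos_iff.2 h0)
      _ = 8 * eLpNorm g 2 volume ^ 2 *
          ∫⁻ h in Metric.ball (0 : EuclideanSpace ℝ (Fin d)) 1, w T ‖h‖ / ‖h‖ₑ ^ d :=
          lintegral_const_mul' _ _ (ENNReal.mul_ne_top (by norm_num)
            (ENNReal.pow_ne_top hg.2.ne))
      _ = 8 * eLpNorm g 2 volume ^ 2 * (S * diniIntegral L m φ u μ₀ T) := by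
          have := lintegral_ball_div_norm_pow (volume : Measure (EuclideanSpace ℝ (Fin d)))
            (isModulus_transportedModulus (u := u) (t := T) hφ hμ).mono
          rw [hfinrank] at this
          rw [this, diniIntegral]
      _ = _ := by
          push_cast
          rw [ENNReal.coe_toNNReal (measure_ne_top _ _)]
          ring
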